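/- Let $G$ be a finite group and let $P$ be the standard complete resolution of $\mathbb{Z}$ over $\mathbb{Z}[G]$. For a bounded complex $N$ of $G$-modules put $R\hat\Gamma(G,N):=\mathrm{Hom}_G(P,N)$, a complex of abelian groups that computes the Tate (hyper)cohomology $\hat H^i(G,N)$; this functor is lax monoidal through the cup product. For a bounded complex $M$ of $G$-modules let $M^\vee:=R\mathrm{Hom}_{\mathbb{Z}}(M,\mathbb{Z})$, with the conjugation action of $G$. The cup product, the evaluation map $M^\vee\otimes^L M\to\mathbb{Z}$ and the injection $\hat H^0(G,\mathbb{Z})=\mathbb{Z}/|G|\mathbb{Z}\hookrightarrow\mathbb{Q}/\mathbb{Z}$, $1\mapsto 1/|G|$, define a natural pairing \[ R\hat\Gamma(G,M^\vee)\otimes^L R\hat\Gamma(G,M)\to R\hat\Gamma(G,\mathbb{Z})\to \hat H^0(G,\mathbb{Z})[0]\hookrightarrow\mathbb{Q}/\mathbb{Z}[0]. \] Theorem. Let $M$ be a bounded complex of $G$-modules all of whose cohomology groups are finitely generated. Then this pairing is perfect, i.e. the adjoint map \[ R\hat\Gamma(G,M^\vee)\to R\mathrm{Hom}_{\mathbb{Z}}\bigl(R\hat\Gamma(G,M),\mathbb{Q}/\mathbb{Z}\bigr)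 \] is an isomorphism in the derived category of abelian groups. -/

import Mathlib

open CategoryTheory

universe u w

set_option linter.unusedSectionVars false

namespace TateDuality

noncomputable section

universe w₁ w₂ w₃

/-! ### Cochains on the standard complete resolution

The standard complete resolution `P` of `ℤ` over a finite group `G` has `P_p = ℤ[G^(p+1)]` for
`p ≥ 0` and `P_p = Hom(ℤ[G^(-p)], ℤ)` for `p < 0`, which is free on the dual basis indexed by
`G^(-p)`.  A `G`-linear map from `P_p` to a `G`-module `A` is therefore the same as a
`G`-equivariant function `G^(len p) → A`.  Tuples are written as lists, and such a function is
extended by zero to the lists of the wrong length. -/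

/-- The length of the tuples that index the standard basis of `P_p`. -/
def len (p : ℤ) : ℕ := if 0 ≤ p then p.toNat + 1 else (-p).toNat

section Raw

variable {G : Type u} [Fintype G] {A : Type w₁} [AddCommGroup A]

/-- `F ↦ ∑ᵢ (-1)ⁱ F(g₀, …, ĝᵢ, …)`. -/
def faceSum (F : List G → A) (L : List G) : A :=
  ∑ i ∈ Finset.range L.length, (-1 : ℤ) ^ i • F (L.eraseIdx i)

/-- `F ↦ ∑ᵢ (-1)ⁱ ∑ₛ F(g₁, …, gᵢ, s, gᵢ₊₁, …)`. -/
def insertSum (F : List G → A) (L : List G) : A :=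
  ∑ i ∈ Finset.range (L.length + 1), (-1 : ℤ) ^ i • ∑ s : G, F (L.insertIdx i s)

/-- Composition of a cochain on `P_(q-1)` with the boundary `P_q → P_(q-1)` of the standard
complete resolution: this boundary is the alternating sum of the faces if `q > 0`, it is
`(g) ↦ ∑ₛ (s)*` if `q = 0`, and it is `(g₁, …)* ↦ ∑ᵢ (-1)ⁱ ∑ₛ (g₁, …, gᵢ, s, gᵢ₊₁, …)*`
if `q < 0`. -/
def coboundary (q : ℤ) (F : List G → A) (L : List G) : A :=
  if 0 < q then faceSum F L
  else if q = 0 then (if L.length = 1 then ∑ s : G, F [s] else 0)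
  else insertSum F L

end Raw

section Cup

variable {G : Type u} [Fintype G] {A : Type w₁} [AddCommGroup A] {B : Type w₂} [AddCommGroup B]
  {C : Type w₃} [AddCommGroup C]

/-- The cup product of cochains `φ` on `P_a` and `ψ` on `P_b` along a bilinear map `β`, that is
`β ∘ (φ ⊗ ψ) ∘ Δ_(a,b)` with the standard complete diagonal `Δ_(a,b) : P_(a+b) → P_a ⊗ P_b`:
* `(g₀, …, g_(a+b)) ↦ (g₀, …, g_a) ⊗ (g_a, …, g_(a+b))` for `a, b ≥ 0`;
* `(g₁, …)* ↦ (g₁, …, g_(-a))* ⊗ (g_(-a+1), …)*` for `a, b < 0`;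
* `(g₀, …) ↦ ∑ₛ (g₀, …, s₁, …, s_(-b)) ⊗ (s_(-b), …, s₁)*` for `a ≥ 0 > b`, `a + b ≥ 0`;
* `(g₁, …)* ↦ ∑ₛ (g₁, s₁, …, s_a) ⊗ (s_a, …, s₁, g₁, …)*` for `a ≥ 0 > b`, `a + b < 0`;
* `(g₀, …) ↦ ∑ₛ (s₁, …, s_(-a))* ⊗ (s_(-a), …, s₁, g₀, …)` for `b ≥ 0 > a`, `a + b ≥ 0`;
* `(g₁, …, g_r)* ↦ ∑ₛ (g₁, …, g_r, s₁, …, s_b)* ⊗ (s_b, …, s₁, g_r)` for `b ≥ 0 > a`,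
  `a + b < 0`. -/
def cup (a b : ℤ) (β : A →+ B →+ C) (φ : List G → A) (ψ : List G → B) (L : List G) : C :=
  if 0 ≤ a then
    if 0 ≤ b then β (φ (L.take (a.toNat + 1))) (ψ (L.drop a.toNat))
    else if 0 ≤ a + b then
      ∑ s : Fin (-b).toNat → G, β (φ (L ++ List.ofFn s)) (ψ (List.ofFn s).reverse)
    else ∑ s : Fin a.toNat → G, β (φ (L.take 1 ++ List.ofFn s)) (ψ ((List.ofFn s).reverse ++ L))
  else if 0 ≤ b then
    if 0 ≤ a + b then
      ∑ s : Fin (-a).toNat → G, β (φ (List.ofFn s)) (ψ ((List.ofFn s).reverse ++ L))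
    else
      ∑ s : Fin b.toNat → G,
        β (φ (L ++ List.ofFn s)) (ψ ((List.ofFn s).reverse ++ L.drop (L.length - 1)))
  else β (φ (L.take (-a).toNat)) (ψ (L.drop (-a).toNat))

end Cup

section RawLemmas

lemma negOnePow_natCast (n : ℕ) : ((n : ℤ).negOnePow : ℤ) = (-1) ^ n := by
  rw [Int.negOnePow_def, zpow_natCast]
  simp

variable {G : Type u} [Fintype G] {A : Type w₁} [AddCommGroup A]

lemma faceSum_nil (F : List G → A) : faceSum F [] = 0 := by simp [faceSum]

lemma faceSum_cons (F : List G → A) (g : G) (L : List G) :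
    faceSum F (g :: L) = F L - faceSum (fun X => F (g :: X)) L := by
  simp only [faceSum, List.length_cons, Finset.sum_range_succ', List.eraseIdx_cons_succ,
    List.eraseIdx_cons_zero, pow_succ]
  simp [Finset.sum_neg_distrib, sub_eq_neg_add]

lemma insertSum_nil (F : List G → A) : insertSum F [] = ∑ s : G, F [s] := by simp [insertSum]

lemma insertSum_cons (F : List G → A) (g : G) (L : List G) :
    insertSum F (g :: L) = ∑ s : G, F (s :: g :: L) - insertSum (fun X => F (g :: X)) L := by
  simp only [insertSum, List.length_cons]
  rw [Finset.sum_range_succ']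
  simp [pow_succ, Finset.sum_neg_distrib, sub_eq_neg_add]

lemma faceSum_add (F F' : List G → A) : faceSum (F + F') = faceSum F + faceSum F' := by
  funext L; simp [faceSum, Finset.sum_add_distrib]

lemma insertSum_add (F F' : List G → A) : insertSum (F + F') = insertSum F + insertSum F' := by
  funext L; simp [insertSum, Finset.sum_add_distrib]

lemma coboundary_add (q : ℤ) (F F' : List G → A) :
    coboundary q (F + F') = coboundary q F + coboundary q F' := by
  funext L
  simp only [coboundary, faceSum_add, insertSum_add, Pi.add_apply]
  split_ifs <;> simp [Finset.sum_add_distrib]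

/-- The coboundary as an additive map, so that linearity is available. -/
def coboundaryHom (q : ℤ) : (List G → A) →+ (List G → A) where
  toFun := coboundary q
  map_zero' := by
    funext L; simp [coboundary, faceSum, insertSum]
  map_add' := coboundary_add q

/-- `faceSum` as an additive map. -/
def faceSumHom : (List G → A) →+ (List G → A) where
  toFun := faceSum
  map_zero' := by funext L; simp [faceSum]
  map_add' := faceSum_add

/-- `insertSum` as an additive map. -/
def insertSumHom : (List G → A) →+ (List G → A) where
  toFun := insertSum
  map_zero' := by funext L; simp [insertSum]
  map_add' := insertSum_add

lemma faceSum_sub (F F' : List G → A) : faceSum (F - F') = faceSum F - faceSum F' :=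
  faceSumHom.map_sub F F'

lemma insertSum_sub (F F' : List G → A) : insertSum (F - F') = insertSum F - insertSum F' :=
  insertSumHom.map_sub F F'

lemma insertSum_sum {ι : Type*} (t : Finset ι) (F : ι → List G → A) :
    insertSum (fun L => ∑ i ∈ t, F i L) = fun L => ∑ i ∈ t, insertSum (F i) L := by
  have h := map_sum (insertSumHom (G := G) (A := A)) F t
  have h2 : (fun L => ∑ i ∈ t, F i L) = ∑ i ∈ t, F i := by funext L; simp
  have h3 : (fun L => ∑ i ∈ t, insertSum (F i) L) = ∑ i ∈ t, insertSum (F i) := by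
    funext L; simp
  rw [h2, h3]
  exact h

lemma faceSum_faceSum (F : List G → A) (L : List G) : faceSum (faceSum F) L = 0 := by
  induction L generalizing F with
  | nil => simp [faceSum_nil]
  | cons g L ih =>
    have : (fun X => faceSum F (g :: X)) = F - faceSum (fun X => F (g :: X)) := by
      funext X; rw [faceSum_cons]; rfl
    rw [faceSum_cons, this, faceSum_sub, Pi.sub_apply, ih]
    simp

lemma insertSum_insertSum (F : List G → A) (L : List G) : insertSum (insertSum F) L = 0 := by
  induction L generalizing F with
  | nil =>
    simp only [insertSum_nil, insertSum_cons, Finset.sum_sub_distrib]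
    rw [Finset.sum_comm, sub_self]
  | cons g L ih =>
    have h1 : (fun X => insertSum F (g :: X)) =
        (fun X => ∑ s : G, F (s :: g :: X)) - insertSum (fun X => F (g :: X)) := by
      funext X; rw [insertSum_cons]; rfl
    rw [insertSum_cons, h1, insertSum_sub, Pi.sub_apply, ih, insertSum_sum]
    simp only [insertSum_cons, Finset.sum_sub_distrib]
    rw [Finset.sum_comm]
    simp

lemma faceSum_snoc (F : List G → A) (L : List G) (x : G) :
    faceSum F (L ++ [x]) = faceSum (fun X => F (X ++ [x])) L + (-1 : ℤ) ^ L.length • F L := by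
  induction L generalizing F with
  | nil => simp [faceSum_nil, faceSum_cons]
  | cons g L ih =>
    simp only [List.cons_append, faceSum_cons, ih, List.length_cons, pow_succ]
    simp only [mul_neg, mul_one, neg_smul]
    abel

lemma insertSum_snoc (F : List G → A) (L : List G) (x : G) :
    insertSum F (L ++ [x]) = insertSum (fun X => F (X ++ [x])) L
      + (-1 : ℤ) ^ (L.length + 1) • ∑ s : G, F (L ++ [x, s]) := by
  induction L generalizing F with
  | nil => simp [insertSum_nil, insertSum_cons, sub_eq_add_neg]
  | cons g L ih =>
    simp only [List.cons_append, insertSum_cons, ih, List.length_cons, pow_succ]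
    simp only [mul_neg, mul_one, neg_smul, neg_neg]
    abel

lemma sum_ofFn_cons (q : ℕ) (F : List G → A) :
    ∑ s : Fin (q + 1) → G, F (List.ofFn s) = ∑ g : G, ∑ s : Fin q → G, F (g :: List.ofFn s) := by
  rw [← (Fin.consEquiv (fun _ => G)).sum_comp, Fintype.sum_prod_type]
  simp [Fin.consEquiv, List.ofFn_succ]

lemma sum_ofFn_reverse (q : ℕ) (F : List G → A) :
    ∑ s : Fin q → G, F (List.ofFn s).reverse = ∑ s : Fin q → G, F (List.ofFn s) := by
  rw [← (Equiv.arrowCongr (Fin.revPerm (n := q)) (Equiv.refl G)).sum_comp]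
  refine Finset.sum_congr rfl fun s _ => ?_
  congr 1
  apply List.ext_getElem <;> simp [Fin.rev]
  intro i h
  congr 2
  omega

lemma faceSum_comp {B : Type w₂} [AddCommGroup B] (T : A →+ B) (F : List G → A)
    (L : List G) : faceSum (fun X => T (F X)) L = T (faceSum F L) := by
  simp [faceSum, map_zsmul]

lemma insertSum_comp {B : Type w₂} [AddCommGroup B] (T : A →+ B) (F : List G → A)
    (L : List G) : insertSum (fun X => T (F X)) L = T (insertSum F L) := by
  simp [insertSum, map_zsmul]

lemma coboundary_comp {B : Type w₂} [AddCommGroup B] (T : A →+ B) (q : ℤ) (F : List G → A)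
    (L : List G) : coboundary q (fun X => T (F X)) L = T (coboundary q F L) := by
  simp only [coboundary, faceSum_comp, insertSum_comp]
  split_ifs <;> simp

lemma faceSum_map (e : G ≃ G) (F : List G → A) (L : List G) :
    faceSum F (L.map e) = faceSum (fun X => F (X.map e)) L := by
  induction L generalizing F with
  | nil => simp [faceSum_nil]
  | cons g L ih => simp [faceSum_cons, ih]

lemma insertSum_map (e : G ≃ G) (F : List G → A) (L : List G) :
    insertSum F (L.map e) = insertSum (fun X => F (X.map e)) L := by
  induction L generalizing F with
  | nil =>
    simp only [List.map_nil, insertSum_nil, List.map_cons]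
    exact (e.sum_comp (fun s => F [s])).symm
  | cons g L ih =>
    simp only [List.map_cons, insertSum_cons, ih]
    rw [← e.sum_comp]

lemma coboundary_map (q : ℤ) (e : G ≃ G) (F : List G → A) (L : List G) :
    coboundary q F (L.map e) = coboundary q (fun X => F (X.map e)) L := by
  simp only [coboundary, faceSum_map, insertSum_map, List.length_map, List.map_cons, List.map_nil]
  rw [← e.sum_comp (fun s => F [s])]

lemma coboundary_coboundary (q r : ℤ) (h : q + 1 = r) (F : List G → A) :
    coboundary r (coboundary q F) = 0 := by
  funext L
  rcases lt_trichotomy q (-1) with hq | hq | hq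
  · have e1 : coboundary q F = insertSum F := by
      funext X; rw [coboundary, if_neg (by omega), if_neg (by omega)]
    rw [e1, coboundary, if_neg (by omega), if_neg (by omega), insertSum_insertSum]; rfl
  · have e1 : coboundary q F = insertSum F := by
      funext X; rw [coboundary, if_neg (by omega), if_neg (by omega)]
    rw [e1, coboundary, if_neg (by omega), if_pos (by omega)]
    split_ifs
    · simp only [insertSum_nil, insertSum_cons, Finset.sum_sub_distrib]
      rw [Finset.sum_comm, sub_self]; rfl
    · rfl
  · rcases eq_or_lt_of_le (show 0 ≤ q by omega) with h0 | h0
    · subst h0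
      rw [coboundary, if_pos (by omega)]
      have e1 : coboundary 0 F = fun X : List G => if X.length = 1 then ∑ s : G, F [s] else 0 := by
        funext X; simp [coboundary]
      rw [e1]
      match L with
      | [] => simp [faceSum_nil]
      | [a] => simp [faceSum_cons, faceSum_nil]
      | [a, b] => simp [faceSum_cons, faceSum_nil]
      | a :: b :: c :: L =>
        simp only [faceSum, List.length_cons, Pi.zero_apply]
        refine Finset.sum_eq_zero fun i hi => ?_
        rw [if_neg, smul_zero]
        have := Finset.mem_range.1 hi
        rw [List.length_eraseIdx]
        simp only [List.length_cons]
        split_ifs <;> omega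
    · have e1 : coboundary q F = faceSum F := by
        funext X; rw [coboundary, if_pos h0]
      rw [e1, coboundary, if_pos (by omega), faceSum_faceSum]; rfl

/-- The coboundary preserves the condition on the length of the tuples. -/
lemma coboundary_support (p q : ℤ) (h : p + 1 = q) (F : List G → A)
    (hF : ∀ L : List G, L.length ≠ len p → F L = 0) (L : List G) (hL : L.length ≠ len q) :
    coboundary q F L = 0 := by
  simp only [len] at hF hL
  rw [coboundary]
  split_ifs with h1 h2 h3
  · refine Finset.sum_eq_zero fun i hi => ?_
    have := Finset.mem_range.1 hi
    rw [hF, smul_zero]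
    rw [List.length_eraseIdx]
    split_ifs at * <;> omega
  · exfalso; apply hL; rw [if_pos (by omega)]; omega
  · rfl
  · refine Finset.sum_eq_zero fun i hi => ?_
    have := Finset.mem_range.1 hi
    rw [Finset.sum_eq_zero, smul_zero]
    intro s _
    apply hF
    rw [List.length_insertIdx]
    split_ifs at * <;> omega

section Adjunction

variable {B : Type w₂} [AddCommGroup B] {C : Type w₃} [AddCommGroup C]

/-- The two parts of the boundary are adjoint to each other under the reversal pairing. -/
lemma sum_faceSum_left (q : ℕ) (β : A →+ B →+ C) (φ : List G → A) (ψ : List G → B) :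
    ∑ s : Fin (q + 1) → G, β (faceSum φ (List.ofFn s)) (ψ (List.ofFn s).reverse) =
      (-1 : ℤ) ^ q • ∑ s : Fin q → G, β (φ (List.ofFn s)) (insertSum ψ (List.ofFn s).reverse) := by
  induction q generalizing φ ψ with
  | zero =>
    rw [sum_ofFn_cons 0 (fun L => β (faceSum φ L) (ψ L.reverse))]
    simp [faceSum_cons, faceSum_nil, insertSum_nil]
  | succ q ih =>
    rw [sum_ofFn_cons (q + 1) (fun L => β (faceSum φ L) (ψ L.reverse)),
      sum_ofFn_cons q (fun L => β (φ L) (insertSum ψ L.reverse))]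
    simp only [faceSum_cons, List.reverse_cons, insertSum_snoc, map_sub, map_add,
      AddMonoidHom.sub_apply, Finset.sum_sub_distrib, Finset.sum_add_distrib, List.length_reverse,
      List.length_ofFn, map_zsmul, map_sum]
    have ih' := fun g : G => ih (fun X => φ (g :: X)) (fun X => ψ (X ++ [g]))
    simp only [ih', ← Finset.smul_sum, smul_add, smul_smul, pow_succ]
    have h1 : ∀ g : G, ∑ s : Fin (q + 1) → G, β (φ (List.ofFn s)) (ψ ((List.ofFn s).reverse ++ [g]))
        = ∑ x : G, ∑ t : Fin q → G,
          β (φ (x :: List.ofFn t)) (ψ ((List.ofFn t).reverse ++ [x, g])) := by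
      intro g
      rw [sum_ofFn_cons q (fun L => β (φ L) (ψ (L.reverse ++ [g])))]
      simp
    simp only [h1]
    have h2 : ∑ g : G, ∑ x : G, ∑ t : Fin q → G,
          β (φ (x :: List.ofFn t)) (ψ ((List.ofFn t).reverse ++ [x, g]))
        = ∑ x : G, ∑ t : Fin q → G, ∑ g : G,
          β (φ (x :: List.ofFn t)) (ψ ((List.ofFn t).reverse ++ [x, g])) := by
      rw [Finset.sum_comm]
      refine Finset.sum_congr rfl fun x _ => ?_
      rw [Finset.sum_comm]
    rw [h2]
    have h3 : ((-1 : ℤ) ^ q * -1 * ((-1) ^ q * -1 )) = 1 := by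
      have : ((-1 : ℤ) ^ q) * (-1) ^ q = 1 := by rw [← mul_pow]; simp
      linarith
    simp only [h3, one_smul]
    simp only [mul_neg, mul_one, neg_smul]
    abel

lemma sum_faceSum_right (q : ℕ) (β : A →+ B →+ C) (φ : List G → A) (ψ : List G → B) :
    ∑ s : Fin (q + 1) → G, β (φ (List.ofFn s)) (faceSum ψ (List.ofFn s).reverse) =
      (-1 : ℤ) ^ q • ∑ s : Fin q → G, β (insertSum φ (List.ofFn s)) (ψ (List.ofFn s).reverse) := by
  have := sum_faceSum_left q β.flip ψ φ
  simp only [AddMonoidHom.flip_apply] at this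
  rw [← sum_ofFn_reverse _ (fun L => β (φ L) (faceSum ψ L.reverse)),
    ← sum_ofFn_reverse _ (fun L => β (insertSum φ L) (ψ L.reverse))]
  simpa using this

lemma coboundary_of_pos {q : ℤ} (hq : 0 < q) (φ : List G → A) :
    coboundary q φ = faceSum φ := by funext L; rw [coboundary, if_pos hq]

lemma coboundary_of_neg {q : ℤ} (hq : q < 0) (φ : List G → A) :
    coboundary q φ = insertSum φ := by
  funext L; rw [coboundary, if_neg (by omega), if_neg (by omega)]

lemma coboundary_zero_singleton (φ : List G → A) (x : G) :
    coboundary 0 φ [x] = ∑ s : G, φ [s] := by simp [coboundary]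

/-- The Leibniz rule for the cup product, from total degree `-1` to total degree `0`. -/
lemma cup_leibniz_zero (a b : ℤ) (h : a + b = -1) (β : A →+ B →+ C)
    (φ : List G → A) (ψ : List G → B) (x : G) :
    ∑ s : G, cup a b β φ ψ [s] =
      cup (a + 1) b β (coboundary (a + 1) φ) ψ [x]
        + (a.negOnePow : ℤ) • cup a (b + 1) β φ (coboundary (b + 1) ψ) [x] := by
  rcases le_or_gt 0 a with ha | ha
  · obtain ⟨n, rfl⟩ := Int.eq_ofNat_of_zero_le ha
    obtain rfl : b = -(n : ℤ) - 1 := by omega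
    have e1 : ∑ s : G, cup (n : ℤ) (-(n : ℤ) - 1) β φ ψ [s] =
        ∑ s : Fin (n + 1) → G, β (φ (List.ofFn s)) (ψ (List.ofFn s).reverse) := by
      rw [sum_ofFn_cons n (fun L => β (φ L) (ψ L.reverse))]
      refine Finset.sum_congr rfl fun s _ => ?_
      rw [cup, if_pos (by omega), if_neg (by omega), if_neg (by omega)]
      simp
    have e2 : cup ((n : ℤ) + 1) (-(n : ℤ) - 1) β (coboundary ((n : ℤ) + 1) φ) ψ [x] =
        ∑ s : Fin (n + 1) → G, β (faceSum φ (x :: List.ofFn s)) (ψ (List.ofFn s).reverse) := by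
      rw [cup, if_pos (by omega), if_neg (by omega), if_pos (by omega),
        coboundary_of_pos (by omega), show (-(-(n : ℤ) - 1)).toNat = n + 1 by omega]
      simp
    have e3 : cup (n : ℤ) (-(n : ℤ) - 1 + 1) β φ (coboundary (-(n : ℤ) - 1 + 1) ψ) [x] =
        ∑ s : Fin n → G, β (φ (x :: List.ofFn s)) (insertSum ψ (List.ofFn s).reverse) := by
      rcases n with _ | n
      · simp [cup, coboundary, insertSum_nil]
      · rw [cup, if_pos (by omega), if_neg (by omega), if_pos (by omega),
          coboundary_of_neg (by omega), show (-(-((n + 1 : ℕ) : ℤ) - 1 + 1)).toNat = n + 1 by omega]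
        simp
    rw [e1, e2, e3]
    simp only [faceSum_cons, map_sub, AddMonoidHom.sub_apply, Finset.sum_sub_distrib]
    rw [sum_faceSum_left n β (fun X => φ (x :: X)) ψ, negOnePow_natCast]
    abel
  · obtain ⟨n, rfl⟩ : ∃ n : ℕ, a = -(n : ℤ) - 1 := ⟨(-a - 1).toNat, by omega⟩
    obtain rfl : b = n := by omega
    have e1 : ∑ s : G, cup (-(n : ℤ) - 1) n β φ ψ [s] =
        ∑ s : Fin (n + 1) → G, β (φ (List.ofFn s)) (ψ (List.ofFn s).reverse) := by
      rw [sum_ofFn_cons n (fun L => β (φ L) (ψ L.reverse))]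
      refine Finset.sum_congr rfl fun s _ => ?_
      rw [cup, if_neg (by omega), if_pos (by omega), if_neg (by omega)]
      simp
    have e3 : cup (-(n : ℤ) - 1) ((n : ℤ) + 1) β φ (coboundary ((n : ℤ) + 1) ψ) [x] =
        ∑ s : Fin (n + 1) → G, β (φ (List.ofFn s)) (faceSum ψ ((List.ofFn s).reverse ++ [x])) := by
      rw [cup, if_neg (by omega), if_pos (by omega), if_pos (by omega),
        coboundary_of_pos (by omega), show (-(-(n : ℤ) - 1)).toNat = n + 1 by omega]
    have e2 : cup (-(n : ℤ) - 1 + 1) n β (coboundary (-(n : ℤ) - 1 + 1) φ) ψ [x] =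
        ∑ s : Fin n → G, β (insertSum φ (List.ofFn s)) (ψ ((List.ofFn s).reverse ++ [x])) := by
      rcases n with _ | n
      · simp [cup, coboundary, insertSum_nil]
      · rw [cup, if_neg (by omega), if_pos (by omega), if_pos (by omega),
          coboundary_of_neg (by omega), show (-(-((n + 1 : ℕ) : ℤ) - 1 + 1)).toNat = n + 1 by omega]
    rw [e1, e2, e3]
    simp only [faceSum_snoc, map_add, Finset.sum_add_distrib, List.length_reverse,
      List.length_ofFn, map_zsmul]
    rw [sum_faceSum_right n β φ (fun X => ψ (X ++ [x]))]
    have hs : ((-(n : ℤ) - 1).negOnePow : ℤ) = (-1) ^ (n + 1) := by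
      rw [show (-(n : ℤ) - 1) = -((n + 1 : ℕ) : ℤ) by push_cast; ring, Int.negOnePow_neg,
        negOnePow_natCast]
    have h2 : ((-1 : ℤ) ^ n) * (-1) ^ n = 1 := by rw [← mul_pow]; simp
    rw [hs, ← Finset.smul_sum]
    simp only [smul_add, smul_smul, pow_succ]
    simp [h2]

/-- The Leibniz rule for the cup product, from total degree `-2` to total degree `-1`. -/
lemma cup_leibniz_neg_one (a b : ℤ) (h : a + b = -2) (β : A →+ B →+ C)
    (φ : List G → A) (ψ : List G → B) (x : G) :
    insertSum (cup a b β φ ψ) [x] =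
      cup (a + 1) b β (coboundary (a + 1) φ) ψ [x]
        + (a.negOnePow : ℤ) • cup a (b + 1) β φ (coboundary (b + 1) ψ) [x] := by
  rw [insertSum_cons, insertSum_nil]
  rcases le_or_gt 0 a with ha | ha
  · obtain ⟨n, rfl⟩ := Int.eq_ofNat_of_zero_le ha
    obtain rfl : b = -(n : ℤ) - 2 := by omega
    have e0 : ∀ u v : G, cup (n : ℤ) (-(n : ℤ) - 2) β φ ψ [u, v] =
        ∑ s : Fin n → G, β (φ (u :: List.ofFn s)) (ψ ((List.ofFn s).reverse ++ [u, v])) := by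
      intro u v
      rw [cup, if_pos (by omega), if_neg (by omega), if_neg (by omega)]
      simp
    have e1 : ∑ s : G, cup (n : ℤ) (-(n : ℤ) - 2) β φ ψ [s, x] =
        ∑ s : Fin (n + 1) → G, β (φ (List.ofFn s)) (ψ ((List.ofFn s).reverse ++ [x])) := by
      rw [sum_ofFn_cons n (fun L => β (φ L) (ψ (L.reverse ++ [x])))]
      simp [e0]
    have e2 : cup ((n : ℤ) + 1) (-(n : ℤ) - 2) β (coboundary ((n : ℤ) + 1) φ) ψ [x] =
        ∑ s : Fin (n + 1) → G,
          β (faceSum φ (x :: List.ofFn s)) (ψ ((List.ofFn s).reverse ++ [x])) := by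
      rw [cup, if_pos (by omega), if_neg (by omega), if_neg (by omega),
        coboundary_of_pos (by omega)]
      simp
    have e3 : cup (n : ℤ) (-(n : ℤ) - 2 + 1) β φ (coboundary (-(n : ℤ) - 2 + 1) ψ) [x] =
        ∑ s : Fin n → G, β (φ (x :: List.ofFn s)) (insertSum ψ ((List.ofFn s).reverse ++ [x])) := by
      rw [cup, if_pos (by omega), if_neg (by omega), if_neg (by omega),
          coboundary_of_neg (by omega)]
      simp
    rw [e1, e2, e3]
    simp only [faceSum_cons, map_sub, AddMonoidHom.sub_apply, Finset.sum_sub_distrib, insertSum_snoc,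
      map_add, Finset.sum_add_distrib, List.length_reverse, List.length_ofFn, map_zsmul, map_sum, e0]
    rw [sum_faceSum_left n β (fun X => φ (x :: X)) (fun X => ψ (X ++ [x]))]
    have h2 : ((-1 : ℤ) ^ n) * (-1) ^ n = 1 := by rw [← mul_pow]; simp
    have hs : ((n : ℤ).negOnePow : ℤ) = (-1) ^ n := negOnePow_natCast n
    rw [hs, ← Finset.smul_sum]
    simp only [smul_add, smul_smul, pow_succ]
    rw [Finset.sum_comm]
    simp [h2]
    abel
  · rcases eq_or_lt_of_le (show a ≤ -1 by omega) with rfl | ha1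
    · obtain rfl : b = -1 := by omega
      simp [cup, coboundary]
      abel
    · obtain ⟨n, rfl⟩ : ∃ n : ℕ, a = -(n : ℤ) - 2 := ⟨(-a - 2).toNat, by omega⟩
      obtain rfl : b = n := by omega
      have e0 : ∀ u v : G, cup (-(n : ℤ) - 2) n β φ ψ [u, v] =
          ∑ s : Fin n → G, β (φ (u :: v :: List.ofFn s)) (ψ ((List.ofFn s).reverse ++ [v])) := by
        intro u v
        rw [cup, if_neg (by omega), if_pos (by omega), if_neg (by omega)]
        simp
      have e1 : ∑ s : G, cup (-(n : ℤ) - 2) n β φ ψ [x, s] =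
          ∑ s : Fin (n + 1) → G, β (φ (x :: List.ofFn s)) (ψ (List.ofFn s).reverse) := by
        rw [sum_ofFn_cons n (fun L => β (φ (x :: L)) (ψ L.reverse))]
        simp [e0]
      have e3 : cup (-(n : ℤ) - 2) ((n : ℤ) + 1) β φ (coboundary ((n : ℤ) + 1) ψ) [x] =
          ∑ s : Fin (n + 1) → G,
            β (φ (x :: List.ofFn s)) (faceSum ψ ((List.ofFn s).reverse ++ [x])) := by
        rw [cup, if_neg (by omega), if_pos (by omega), if_neg (by omega),
          coboundary_of_pos (by omega)]
        simp
      have e2 : cup (-(n : ℤ) - 2 + 1) n β (coboundary (-(n : ℤ) - 2 + 1) φ) ψ [x] =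
          ∑ s : Fin n → G,
            β (insertSum φ (x :: List.ofFn s)) (ψ ((List.ofFn s).reverse ++ [x])) := by
        rw [cup, if_neg (by omega), if_pos (by omega), if_neg (by omega),
          coboundary_of_neg (by omega)]
        simp
      rw [e1, e2, e3]
      simp only [faceSum_snoc, insertSum_cons, map_add, Finset.sum_add_distrib, List.length_reverse,
        List.length_ofFn, map_zsmul, map_sub, AddMonoidHom.sub_apply, Finset.sum_sub_distrib, map_sum,
        AddMonoidHom.finsetSum_apply, e0]
      rw [sum_faceSum_right n β (fun X => φ (x :: X)) (fun X => ψ (X ++ [x]))]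
      have hs : ((-(n : ℤ) - 2).negOnePow : ℤ) = (-1) ^ n := by
        rw [show (-(n : ℤ) - 2) = -((n + 2 : ℕ) : ℤ) by push_cast; ring, Int.negOnePow_neg,
          negOnePow_natCast]
        simp [pow_add]
      have h2 : ((-1 : ℤ) ^ n) * (-1) ^ n = 1 := by rw [← mul_pow]; simp
      rw [hs, ← Finset.smul_sum]
      simp only [smul_add, smul_smul, pow_succ]
      rw [Finset.sum_comm]
      simp [h2]
      abel

end Adjunction

end RawLemmas

section TateComplex

variable {G : Type u} [Group G]

/-- The additive map underlying a map of `G`-modules. -/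
def homAdd {A B : Rep.{w} ℤ G} (f : A ⟶ B) : A →+ B := AddMonoidHom.mk' f.hom (map_add f.hom)

/-- The additive map by which a group element acts on a `G`-module. -/
def actAdd (A : Rep.{w} ℤ G) (g : G) : A →+ A := AddMonoidHom.mk' (A.ρ g) (map_add (A.ρ g))

@[simp] lemma homAdd_apply {A B : Rep.{w} ℤ G} (f : A ⟶ B) (x : A) : homAdd f x = f.hom x := rfl

@[simp] lemma actAdd_apply (A : Rep.{w} ℤ G) (g : G) (x : A) : actAdd A g x = A.ρ g x := rfl

lemma homAdd_actAdd {A B : Rep.{w} ℤ G} (f : A ⟶ B) (g : G) (x : A) :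
    homAdd f (actAdd A g x) = actAdd B g (homAdd f x) := Rep.hom_comm_apply f g x

lemma homAdd_homAdd {A B C : Rep.{w} ℤ G} (f : A ⟶ B) (g : B ⟶ C) (h : f ≫ g = 0) (x : A) :
    homAdd g (homAdd f x) = 0 := by
  change g.hom (f.hom x) = 0
  rw [← Rep.comp_apply, h]
  rfl

/-- `Hom_G(P_p, A)`: the Tate cochains of degree `p` with values in the `G`-module `A`, as
equivariant functions on the standard basis of `P_p`. -/
def tateCochains (A : Rep.{w} ℤ G) (p : ℤ) : AddSubgroup (List G → A) where
  carrier := {F | (∀ (g : G) (L : List G), F (L.map (g * ·)) = A.ρ g (F L)) ∧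
    ∀ L : List G, L.length ≠ len p → F L = 0}
  zero_mem' := by simp
  add_mem' := by
    rintro F F' ⟨h1, h2⟩ ⟨h1', h2'⟩
    exact ⟨fun g L => by simp [h1, h1'], fun L hL => by simp [h2 L hL, h2' L hL]⟩
  neg_mem' := by
    rintro F ⟨h1, h2⟩
    exact ⟨fun g L => by simp [h1], fun L hL => by simp [h2 L hL]⟩

/-- The map on Tate cochains that is induced by a map of `G`-modules. -/
def tateCochainsMap {A B : Rep.{w} ℤ G} (f : A ⟶ B) (p : ℤ) :
    tateCochains A p →+ tateCochains B p where
  toFun F := ⟨fun L => f.hom (F.1 L), fun g L => by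
    simp only [F.2.1 g L, Rep.hom_comm_apply], fun L hL => by simp only [F.2.2 L hL, map_zero]⟩
  map_zero' := by ext L; simp
  map_add' F F' := by ext L; simp

lemma tateCochainsMap_comp {A B C : Rep.{w} ℤ G} (f : A ⟶ B) (g : B ⟶ C) (h : f ≫ g = 0)
    (p : ℤ) (F : tateCochains A p) : tateCochainsMap g p (tateCochainsMap f p F) = 0 := by
  ext L
  exact homAdd_homAdd f g h (F.1 L)

variable [Fintype G]

/-- The differential `Hom_G(P_p, A) → Hom_G(P_q, A)`, where `p + 1 = q`. -/
def tateCoboundary (A : Rep.{w} ℤ G) (p q : ℤ) (h : p + 1 = q) :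
    tateCochains A p →+ tateCochains A q where
  toFun F := ⟨coboundary q F.1, fun g L => by
      have h1 := coboundary_map q (Equiv.mulLeft g) F.1 L
      have h2 : (fun X : List G => F.1 (X.map (Equiv.mulLeft g))) =
          fun X => actAdd A g (F.1 X) := by
        funext X; exact F.2.1 g X
      rw [h2, coboundary_comp] at h1
      exact h1,
    coboundary_support p q h F.1 F.2.2⟩
  map_zero' := by ext1; exact (coboundaryHom q).map_zero
  map_add' F F' := by ext1; exact coboundary_add q F.1 F'.1

lemma tateCoboundary_comp (A : Rep.{w} ℤ G) (p q r : ℤ) (h : p + 1 = q) (h' : q + 1 = r)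
    (F : tateCochains A p) : tateCoboundary A q r h' (tateCoboundary A p q h F) = 0 := by
  ext1; exact coboundary_coboundary q r h' F.1

lemma tateCoboundary_map {A B : Rep.{w} ℤ G} (f : A ⟶ B) (p q : ℤ) (h : p + 1 = q)
    (F : tateCochains A p) :
    tateCoboundary B p q h (tateCochainsMap f p F) =
      tateCochainsMap f q (tateCoboundary A p q h F) := by
  ext L; exact coboundary_comp (homAdd f) q F.1 L

/-- The terms of the complex `Hom_G(P, M)`: in degree `n`, the product of the groups
`Hom_G(P_p, M^j)` over all pairs `(p, j)` with `p + j = n`. -/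
abbrev TateTerm (M : CochainComplex (Rep.{w} ℤ G) ℤ) (n : ℤ) : Type (max u w) :=
  ∀ x : {x : ℤ × ℤ // x.1 + x.2 = n}, tateCochains (M.X x.1.2) x.1.1

/-- The component of a cochain in `Hom_G(P_p, M^j)`. -/
abbrev TateTerm.comp {M : CochainComplex (Rep.{w} ℤ G) ℤ} {n : ℤ} (f : TateTerm M n) (p j : ℤ)
    (h : p + j = n) : tateCochains (M.X j) p := f ⟨(p, j), h⟩

/-- The differential `f ↦ d_M ∘ f - (-1)ⁿ f ∘ d_P` of the complex `Hom_G(P, M)`. -/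
def tateD (M : CochainComplex (Rep.{w} ℤ G) ℤ) (n n' : ℤ) (h : n + 1 = n') :
    TateTerm M n →+ TateTerm M n' where
  toFun f := fun ⟨(p, j), hp⟩ =>
    tateCochainsMap (M.d (j - 1) j) p (f.comp p (j - 1) (by dsimp only at hp; omega)) -
      (n.negOnePow : ℤ) • tateCoboundary (M.X j) (p - 1) p (by omega)
        (f.comp (p - 1) j (by dsimp only at hp; omega))
  map_zero' := by
    funext x
    simp [TateTerm.comp]
  map_add' f f' := by
    funext x
    simp only [TateTerm.comp, Pi.add_apply, map_add, smul_add]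
    abel

lemma tateD_tateD (M : CochainComplex (Rep.{w} ℤ G) ℤ) (n n' n'' : ℤ) (h : n + 1 = n')
    (h' : n' + 1 = n'') (f : TateTerm M n) : tateD M n' n'' h' (tateD M n n' h f) = 0 := by
  subst h
  funext x
  simp only [tateD, TateTerm.comp, AddMonoidHom.coe_mk, ZeroHom.coe_mk, map_sub, map_zsmul,
    tateCoboundary_comp, tateCoboundary_map, Int.negOnePow_succ]
  rw [tateCochainsMap_comp _ _ (M.d_comp_d _ _ _)]
  simp

/-- The Tate complex `RΓ̂(G, M) = Hom_G(P, M)` of a bounded complex `M` of `G`-modules, where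
`P` is the standard complete resolution of `ℤ`. -/
def tateComplex (M : CochainComplex (Rep.{w} ℤ G) ℤ) :
    CochainComplex AddCommGrpCat.{max u w} ℤ where
  X n := AddCommGrpCat.of (TateTerm M n)
  d n n' := if h : n + 1 = n' then AddCommGrpCat.ofHom (tateD M n n' h) else 0
  shape n n' h := dif_neg h
  d_comp_d' n n' n'' h h' := by
    rw [dif_pos (show n + 1 = n' from h), dif_pos (show n' + 1 = n'' from h')]
    exact AddCommGrpCat.hom_ext (AddMonoidHom.ext fun f => tateD_tateD M n n' n'' h h' f)

end TateComplex

section Dual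

variable {G : Type u} [Group G]

/-- The terms of the complex `Hom(M, [ℚ → ℚ/ℤ])` of homomorphisms of abelian groups: in degree
`n`, the group `Hom(M^(-n), ℚ) × Hom(M^(1-n), ℚ/ℤ)`. -/
abbrev DualTerm (M : CochainComplex (Rep.{w} ℤ G) ℤ) (n : ℤ) : Type w :=
  (∀ q : {q : ℤ // q + n = 0}, M.X q →+ ℚ) × (∀ q : {q : ℤ // q + n = 1}, M.X q →+ AddCircle (1 : ℚ))

/-- The action of `G` on the terms of the dual: `(g • f)(x) = f(g⁻¹ x)`. -/
def dualRep (M : CochainComplex (Rep.{w} ℤ G) ℤ) (n : ℤ) :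
    Representation ℤ G (DualTerm M n) where
  toFun g := AddMonoidHom.toIntLinearMap
    { toFun := fun f =>
        (fun q => (f.1 q).comp (actAdd (M.X q) g⁻¹), fun q => (f.2 q).comp (actAdd (M.X q) g⁻¹))
      map_zero' := rfl
      map_add' := fun _ _ => rfl }
  map_one' := by
    refine LinearMap.ext fun f => Prod.ext ?_ ?_ <;> funext q <;> ext x <;> simp
  map_mul' g g' := by
    refine LinearMap.ext fun f => Prod.ext ?_ ?_ <;> funext q <;> ext x <;> simp

/-- The differential `f ↦ d ∘ f - (-1)ⁿ f ∘ d_M` of the complex `Hom(M, [ℚ → ℚ/ℤ])`. -/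
def dualD (M : CochainComplex (Rep.{w} ℤ G) ℤ) (n n' : ℤ) (h : n + 1 = n') :
    DualTerm M n →+ DualTerm M n' where
  toFun f :=
    (fun ⟨q, hq⟩ => -((n.negOnePow : ℤ) •
        (f.1 ⟨q + 1, by omega⟩).comp (homAdd (M.d q (q + 1)))),
      fun ⟨q, hq⟩ => (QuotientAddGroup.mk' (AddSubgroup.zmultiples (1 : ℚ))).comp
          (f.1 ⟨q, by omega⟩) -
        (n.negOnePow : ℤ) • (f.2 ⟨q + 1, by omega⟩).comp (homAdd (M.d q (q + 1))))
  map_zero' := by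
    refine Prod.ext ?_ ?_ <;> funext q <;> ext x <;> simp
  map_add' f f' := by
    refine Prod.ext ?_ ?_ <;> funext q <;> ext x <;> simp <;> abel

lemma dualD_dualD (M : CochainComplex (Rep.{w} ℤ G) ℤ) (n n' n'' : ℤ) (h : n + 1 = n')
    (h' : n' + 1 = n'') (f : DualTerm M n) : dualD M n' n'' h' (dualD M n n' h f) = 0 := by
  subst h
  have hd : ∀ (q : ℤ) (x : M.X q),
      homAdd (M.d (q + 1) (q + 1 + 1)) (homAdd (M.d q (q + 1)) x) = 0 :=
    fun q x => homAdd_homAdd _ _ (M.d_comp_d _ _ _) x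
  refine Prod.ext ?_ ?_ <;> funext q <;> ext x
  · simp [dualD, -homAdd_apply, hd]
  · simp only [dualD, AddMonoidHom.coe_mk, ZeroHom.coe_mk, AddMonoidHom.sub_apply,
      AddMonoidHom.comp_apply, AddMonoidHom.neg_apply, AddMonoidHom.zsmul_apply, map_neg,
      map_zsmul, hd, Int.negOnePow_succ, Pi.zero_apply, Prod.snd_zero, AddMonoidHom.zero_apply]
    simp [-QuotientAddGroup.mk'_apply, -homAdd_apply]

lemma dualD_act (M : CochainComplex (Rep.{w} ℤ G) ℤ) (n n' : ℤ) (h : n + 1 = n') (g : G)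
    (f : DualTerm M n) : dualD M n n' h (dualRep M n g f) = dualRep M n' g (dualD M n n' h f) := by
  refine Prod.ext ?_ ?_ <;> funext q <;> ext x
  · simp [dualD, dualRep, -homAdd_apply, -actAdd_apply, homAdd_actAdd]
  · simp [dualD, dualRep, -homAdd_apply, -actAdd_apply, homAdd_actAdd]

/-- The derived dual `M^∨ = RHom(M, ℤ)` of a complex `M` of `G`-modules, computed by the injective
resolution `ℚ → ℚ/ℤ` of the abelian group `ℤ`, with the conjugation action of `G`. -/
def dual (M : CochainComplex (Rep.{w} ℤ G) ℤ) : CochainComplex (Rep.{w} ℤ G) ℤ where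
  X n := Rep.of (dualRep M n)
  d n n' := if h : n + 1 = n' then
    Rep.ofHom (LinearMap.intertwiningMap_of_isIntertwiningMap _ _ (dualD M n n' h).toIntLinearMap
      (fun g f => by exact dualD_act M n n' h g f)) else 0
  shape n n' h := dif_neg h
  d_comp_d' n n' n'' h h' := by
    rw [dif_pos (show n + 1 = n' from h), dif_pos (show n' + 1 = n'' from h')]
    exact Rep.hom_ext (DFunLike.ext _ _ fun f => dualD_dualD M n n' n'' h h' f)

/-- The component `(M^∨)^n × M^q → ℚ`, where `q + n = 0`, of the evaluation pairing
`M^∨ ⊗ M → [ℚ → ℚ/ℤ]`. -/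
def evalQ (M : CochainComplex (Rep.{w} ℤ G) ℤ) (n q : ℤ) (h : q + n = 0) :
    (dual M).X n →+ M.X q →+ ℚ where
  toFun f := (show DualTerm M n from f).1 ⟨q, h⟩
  map_zero' := rfl
  map_add' _ _ := rfl

/-- The component `(M^∨)^n × M^q → ℚ/ℤ`, where `q + n = 1`, of the evaluation pairing
`M^∨ ⊗ M → [ℚ → ℚ/ℤ]`. -/
def evalQZ (M : CochainComplex (Rep.{w} ℤ G) ℤ) (n q : ℤ) (h : q + n = 1) :
    (dual M).X n →+ M.X q →+ AddCircle (1 : ℚ) where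
  toFun f := (show DualTerm M n from f).2 ⟨q, h⟩
  map_zero' := rfl
  map_add' _ _ := rfl

end Dual

section Pairing

variable {G : Type u} [Group G] [Fintype G] (M : CochainComplex (Rep.{w} ℤ G) ℤ)

/-- The summand with values in `ℚ` that `M^q` contributes to the cup product of
`f ∈ RΓ̂(G, M^∨)^m` and `g ∈ RΓ̂(G, M)^n`, with the Koszul sign of `(f ⊗ g)(x ⊗ y)`. -/
def cupTermQ {m n : ℤ} (f : TateTerm (dual M) m) (g : TateTerm M n) (q : ℤ) : List G → ℚ :=
  ((n * (m + q)).negOnePow : ℤ) • cup (m + q) (n - q) (evalQ M (-q) q (by omega))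
    (f.comp (m + q) (-q) (by omega)).1 (g.comp (n - q) q (by omega)).1

/-- The summand with values in `ℚ/ℤ` that `M^q` contributes to the cup product of
`f ∈ RΓ̂(G, M^∨)^m` and `g ∈ RΓ̂(G, M)^n`, with the Koszul sign of `(f ⊗ g)(x ⊗ y)`. -/
def cupTermQZ {m n : ℤ} (f : TateTerm (dual M) m) (g : TateTerm M n) (q : ℤ) :
    List G → AddCircle (1 : ℚ) :=
  ((n * (m + q - 1)).negOnePow : ℤ) • cup (m + q - 1) (n - q) (evalQZ M (1 - q) q (by omega))
    (f.comp (m + q - 1) (1 - q) (by omega)).1 (g.comp (n - q) q (by omega)).1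

/-- The pairing `RΓ̂(G, M^∨)^m × RΓ̂(G, M)^n → ℚ/ℤ` for `m + n = 0`: the cup product followed by
the evaluation `M^∨ ⊗ M → [ℚ → ℚ/ℤ]` has a component `a` in `Hom_G(P_0, ℚ)` and a component
`c` in `Hom_G(P_(-1), ℚ/ℤ)`, and the map
`RΓ̂(G, [ℚ → ℚ/ℤ]) → Ĥ⁰(G, ℤ) = ℤ/|G|ℤ ⊂ ℚ/ℤ`, `1 ↦ 1/|G|`, sends `(a, c)` to
`a(1)/|G| - c(1*)`.  The sums over `q` are finite if `M` is bounded. -/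
def pairing {m n : ℤ} (f : TateTerm (dual M) m) (g : TateTerm M n) : AddCircle (1 : ℚ) :=
  (((∑ᶠ q : ℤ, cupTermQ M f g q [1]) / Fintype.card G : ℚ) : AddCircle (1 : ℚ)) -
    ∑ᶠ q : ℤ, cupTermQZ M f g q [1]

/-- A complex is bounded if its terms vanish outside a bounded range of degrees. -/
def IsBounded : Prop := ∃ a b : ℤ, M.IsStrictlyGE a ∧ M.IsStrictlyLE b

end Pairing

section Pontryagin

/-- The complex `Hom(X, ℚ/ℤ) = RHom(X, ℚ/ℤ)` (as `ℚ/ℤ` is injective), with `ℚ/ℤ` in degree `0`: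
in degree `n` it is `Hom(X^(-n), ℚ/ℤ)`, with the differential `f ↦ (-1)^(n+1) f ∘ d`. -/
def pontryaginDual (X : CochainComplex AddCommGrpCat.{w} ℤ) :
    CochainComplex AddCommGrpCat.{w} ℤ where
  X n := AddCommGrpCat.of (X.X (-n) →+ AddCircle (1 : ℚ))
  d n n' := AddCommGrpCat.ofHom (((n + 1).negOnePow : ℤ) •
    AddMonoidHom.mk' (fun f : X.X (-n) →+ AddCircle (1 : ℚ) => f.comp (X.d (-n') (-n)).hom)
      (fun _ _ => rfl))
  shape n n' h := by
    have : X.d (-n') (-n) = 0 := X.shape _ _ (fun h' => h (by simp at h' ⊢; omega))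
    rw [this]
    refine AddCommGrpCat.hom_ext (AddMonoidHom.ext fun f => AddMonoidHom.ext fun x => ?_)
    simp
  d_comp_d' n n' n'' h h' := by
    refine AddCommGrpCat.hom_ext (AddMonoidHom.ext fun f => AddMonoidHom.ext fun x => ?_)
    have : (X.d (-n') (-n)).hom ((X.d (-n'') (-n')).hom x) = 0 := by
      rw [← AddCommGrpCat.comp_apply, X.d_comp_d]
      rfl
    simp [this]

end Pontryagin

section Leibniz

variable {G : Type u} [Fintype G]

/-- The cup product depends additively on the products of the values of the two cochains. -/
lemma cup_linear {A : Type*} [AddCommGroup A] {B : Type*} [AddCommGroup B] {C : Type*}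
    [AddCommGroup C] {A₁ : Type*} [AddCommGroup A₁] {B₁ : Type*} [AddCommGroup B₁] {C₁ : Type*}
    [AddCommGroup C₁] {A₂ : Type*} [AddCommGroup A₂] {B₂ : Type*} [AddCommGroup B₂] {C₂ : Type*}
    [AddCommGroup C₂] (a b : ℤ) (β : A →+ B →+ C) (β₁ : A₁ →+ B₁ →+ C₁) (β₂ : A₂ →+ B₂ →+ C₂)
    (T₁ : C₁ →+ C) (T₂ : C₂ →+ C) (φ : List G → A) (ψ : List G → B) (φ₁ : List G → A₁)
    (ψ₁ : List G → B₁) (φ₂ : List G → A₂) (ψ₂ : List G → B₂)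
    (h : ∀ X Y, β (φ X) (ψ Y) = T₁ (β₁ (φ₁ X) (ψ₁ Y)) + T₂ (β₂ (φ₂ X) (ψ₂ Y))) (L : List G) :
    cup a b β φ ψ L = T₁ (cup a b β₁ φ₁ ψ₁ L) + T₂ (cup a b β₂ φ₂ ψ₂ L) := by
  simp only [cup, h]
  split_ifs <;> simp [Finset.sum_add_distrib, map_sum]

/-- A version of `cup_linear` with three summands. -/
lemma cup_linear₃ {A : Type*} [AddCommGroup A] {B : Type*} [AddCommGroup B] {C : Type*}
    [AddCommGroup C] {A₁ : Type*} [AddCommGroup A₁] {B₁ : Type*} [AddCommGroup B₁] {C₁ : Type*}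
    [AddCommGroup C₁] {A₂ : Type*} [AddCommGroup A₂] {B₂ : Type*} [AddCommGroup B₂] {C₂ : Type*}
    [AddCommGroup C₂] {A₃ : Type*} [AddCommGroup A₃] {B₃ : Type*} [AddCommGroup B₃] {C₃ : Type*}
    [AddCommGroup C₃] (a b : ℤ) (β : A →+ B →+ C) (β₁ : A₁ →+ B₁ →+ C₁) (β₂ : A₂ →+ B₂ →+ C₂)
    (β₃ : A₃ →+ B₃ →+ C₃)
    (T₁ : C₁ →+ C) (T₂ : C₂ →+ C) (T₃ : C₃ →+ C) (φ : List G → A) (ψ : List G → B)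
    (φ₁ : List G → A₁) (ψ₁ : List G → B₁) (φ₂ : List G → A₂) (ψ₂ : List G → B₂)
    (φ₃ : List G → A₃) (ψ₃ : List G → B₃)
    (h : ∀ X Y, β (φ X) (ψ Y) = T₁ (β₁ (φ₁ X) (ψ₁ Y)) + T₂ (β₂ (φ₂ X) (ψ₂ Y)) +
      T₃ (β₃ (φ₃ X) (ψ₃ Y))) (L : List G) :
    cup a b β φ ψ L = T₁ (cup a b β₁ φ₁ ψ₁ L) + T₂ (cup a b β₂ φ₂ ψ₂ L) +
      T₃ (cup a b β₃ φ₃ ψ₃ L) := by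
  simp only [cup, h]
  split_ifs <;> simp only [Finset.sum_add_distrib, map_sum]

/-- The cup product is invariant if the products of the values are. -/
lemma cup_map {A : Type*} [AddCommGroup A] {B : Type*} [AddCommGroup B] {C : Type*}
    [AddCommGroup C] (a b : ℤ) (β : A →+ B →+ C) (φ : List G → A) (ψ : List G → B) (e : G ≃ G)
    (h : ∀ X Y, β (φ (X.map e)) (ψ (Y.map e)) = β (φ X) (ψ Y)) (L : List G) :
    cup a b β φ ψ (L.map e) = cup a b β φ ψ L := by
  have hs : ∀ (q : ℕ) (F : List G → C), ∑ s : Fin q → G, F (List.ofFn s) =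
      ∑ s : Fin q → G, F ((List.ofFn s).map e) := by
    intro q F
    rw [← (Equiv.arrowCongr (Equiv.refl (Fin q)) e).sum_comp]
    refine Finset.sum_congr rfl fun s _ => ?_
    rw [List.map_ofFn]
    rfl
  simp only [cup]
  split_ifs
  · rw [← List.map_take, ← List.map_drop, h]
  · rw [hs _ (fun X => β (φ (L.map e ++ X)) (ψ X.reverse))]
    refine Finset.sum_congr rfl fun s _ => ?_
    rw [← List.map_append, ← List.map_reverse, h]
  · rw [hs _ (fun X => β (φ ((L.map e).take 1 ++ X)) (ψ (X.reverse ++ L.map e)))]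
    refine Finset.sum_congr rfl fun s _ => ?_
    rw [← List.map_take, ← List.map_append, ← List.map_reverse, ← List.map_append, h]
  · rw [hs _ (fun X => β (φ X) (ψ (X.reverse ++ L.map e)))]
    refine Finset.sum_congr rfl fun s _ => ?_
    rw [← List.map_reverse, ← List.map_append, h]
  · rw [hs _ (fun X => β (φ (L.map e ++ X)) (ψ (X.reverse ++ (L.map e).drop _)))]
    refine Finset.sum_congr rfl fun s _ => ?_
    rw [← List.map_append, ← List.map_reverse, ← List.map_drop, ← List.map_append, h,
      List.length_map]
  · rw [← List.map_take, ← List.map_drop, h]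

variable [Group G] (M : CochainComplex (Rep.{w} ℤ G) ℤ)

lemma tateD_comp {n n' : ℤ} (h : n + 1 = n') (f : TateTerm M n) (p p' j j' : ℤ)
    (hp : p' + 1 = p) (hj : j' + 1 = j) (hpj : p + j = n') (L : List G) :
    ((tateD M n n' h f).comp p j hpj).1 L = homAdd (M.d j' j) ((f.comp p j' (by omega)).1 L) -
      (n.negOnePow : ℤ) • coboundary p (f.comp p' j (by omega)).1 L := by
  obtain rfl : j' = j - 1 := by omega
  obtain rfl : p' = p - 1 := by omega
  rfl

lemma evalQ_d (j j' q : ℤ) (hj : j' + 1 = j) (hq : q + j = 0) (F : (dual M).X j') (y : M.X q) :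
    evalQ M j q hq (homAdd ((dual M).d j' j) F) y =
      -((j'.negOnePow : ℤ) • evalQ M j' (q + 1) (by omega) F (homAdd (M.d q (q + 1)) y)) := by
  have : (dual M).d j' j = Rep.ofHom (LinearMap.intertwiningMap_of_isIntertwiningMap _ _
      (dualD M j' j hj).toIntLinearMap (fun g f => by exact dualD_act M j' j hj g f)) :=
    dif_pos hj
  rw [this]
  rfl

lemma evalQZ_d (j j' q : ℤ) (hj : j' + 1 = j) (hq : q + j = 1) (F : (dual M).X j') (y : M.X q) :
    evalQZ M j q hq (homAdd ((dual M).d j' j) F) y =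
      QuotientAddGroup.mk' (AddSubgroup.zmultiples (1 : ℚ)) (evalQ M j' q (by omega) F y) -
      (j'.negOnePow : ℤ) • evalQZ M j' (q + 1) (by omega) F (homAdd (M.d q (q + 1)) y) := by
  have : (dual M).d j' j = Rep.ofHom (LinearMap.intertwiningMap_of_isIntertwiningMap _ _
      (dualD M j' j hj).toIntLinearMap (fun g f => by exact dualD_act M j' j hj g f)) :=
    dif_pos hj
  rw [this]
  rfl

lemma evalQ_act (j q : ℤ) (hq : q + j = 0) (F : (dual M).X j) (y : M.X q) (g : G) :
    evalQ M j q hq (((dual M).X j).ρ g F) ((M.X q).ρ g y) = evalQ M j q hq F y := by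
  change (show DualTerm M j from F).1 ⟨q, hq⟩ ((M.X q).ρ g⁻¹ ((M.X q).ρ g y)) = _
  rw [show (M.X q).ρ g⁻¹ ((M.X q).ρ g y) = y by simp]
  rfl

lemma evalQZ_act (j q : ℤ) (hq : q + j = 1) (F : (dual M).X j) (y : M.X q) (g : G) :
    evalQZ M j q hq (((dual M).X j).ρ g F) ((M.X q).ρ g y) = evalQZ M j q hq F y := by
  change (show DualTerm M j from F).2 ⟨q, hq⟩ ((M.X q).ρ g⁻¹ ((M.X q).ρ g y)) = _
  rw [show (M.X q).ρ g⁻¹ ((M.X q).ρ g y) = y by simp]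
  rfl

variable {M} {m n : ℤ}

lemma cupTermQ_eq (f : TateTerm (dual M) m) (g : TateTerm M n) (q p j r : ℤ) (hp : p = m + q)
    (hj : q + j = 0) (hr : r = n - q) (L : List G) :
    cupTermQ M f g q L = ((n * p).negOnePow : ℤ) • cup p r (evalQ M j q hj)
      (f.comp p j (by omega)).1 (g.comp r q (by omega)).1 L := by
  subst hp hr
  obtain rfl : j = -q := by omega
  rfl

lemma cupTermQZ_eq (f : TateTerm (dual M) m) (g : TateTerm M n) (q p j r : ℤ)
    (hp : p = m + q - 1) (hj : q + j = 1) (hr : r = n - q) (L : List G) :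
    cupTermQZ M f g q L = ((n * p).negOnePow : ℤ) • cup p r (evalQZ M j q hj)
      (f.comp p j (by omega)).1 (g.comp r q (by omega)).1 L := by
  subst hp hr
  obtain rfl : j = 1 - q := by omega
  rfl

/-- The summand that the differential of `M` contributes, with values in `ℚ`. -/
def crossQ (f : TateTerm (dual M) m) (g : TateTerm M n) (q : ℤ) (L : List G) : ℚ :=
  ((m + (n + 1) * (m + q)).negOnePow : ℤ) • cup (m + q) (n - q + 1) (evalQ M (-q) q (by omega))
    (f.comp (m + q) (-q) (by omega)).1
    (fun X => homAdd (M.d (q - 1) q) ((g.comp (n - q + 1) (q - 1) (by omega)).1 X)) L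

/-- The summand that the differential of `M` contributes, with values in `ℚ/ℤ`. -/
def crossQZ (f : TateTerm (dual M) m) (g : TateTerm M n) (q : ℤ) (L : List G) :
    AddCircle (1 : ℚ) :=
  ((m + (n + 1) * (m + q - 1)).negOnePow : ℤ) • cup (m + q - 1) (n - q + 1)
    (evalQZ M (1 - q) q (by omega)) (f.comp (m + q - 1) (1 - q) (by omega)).1
    (fun X => homAdd (M.d (q - 1) q) ((g.comp (n - q + 1) (q - 1) (by omega)).1 X)) L

lemma crossQ_eq (f : TateTerm (dual M) m) (g : TateTerm M n) (q q' p j r : ℤ) (hp : p = m + q)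
    (hj : q + j = 0) (hr : r = n - q + 1) (hq : q' + 1 = q) (L : List G) :
    crossQ f g q L = ((m + (n + 1) * p).negOnePow : ℤ) • cup p r (evalQ M j q hj)
      (f.comp p j (by omega)).1
      (fun X => homAdd (M.d q' q) ((g.comp r q' (by omega)).1 X)) L := by
  subst hp hr
  obtain rfl : j = -q := by omega
  obtain rfl : q' = q - 1 := by omega
  rfl

lemma crossQZ_eq (f : TateTerm (dual M) m) (g : TateTerm M n) (q q' p j r : ℤ)
    (hp : p = m + q - 1) (hj : q + j = 1) (hr : r = n - q + 1) (hq : q' + 1 = q) (L : List G) :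
    crossQZ f g q L = ((m + (n + 1) * p).negOnePow : ℤ) • cup p r (evalQZ M j q hj)
      (f.comp p j (by omega)).1
      (fun X => homAdd (M.d q' q) ((g.comp r q' (by omega)).1 X)) L := by
  subst hp hr
  obtain rfl : j = 1 - q := by omega
  obtain rfl : q' = q - 1 := by omega
  rfl

lemma sgn_mul (a b : ℤ) :
    (a.negOnePow : ℤ) * (b.negOnePow : ℤ) = ((a + b).negOnePow : ℤ) := by
  rw [Int.negOnePow_add]; simp

lemma sgn_even (a b : ℤ) (h : Even (a - b)) : (a.negOnePow : ℤ) = (b.negOnePow : ℤ) := by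
  rw [(Int.negOnePow_eq_iff a b).2 h]

lemma sgn_odd (a b : ℤ) (h : Odd (a - b)) : (a.negOnePow : ℤ) = -(b.negOnePow : ℤ) := by
  rw [← neg_eq_iff_eq_neg, ← sgn_even (a + 1) b (by
    rw [show a + 1 - b = a - b + 1 by ring]; exact h.add_one), Int.negOnePow_succ]
  simp

lemma cupTermQ_leibniz {m' n' : ℤ} (hm : m + 1 = m') (hn : n + 1 = n') (hmn : m + n = -1)
    (f : TateTerm (dual M) m) (g : TateTerm M n) (q : ℤ) (x : G) :
    cupTermQ M (tateD (dual M) m m' hm f) g q [x] +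
      (m.negOnePow : ℤ) • cupTermQ M f (tateD M n n' hn g) q [x] =
      ∑ s : G, cupTermQ M f g q [s] + crossQ f g q [x] - crossQ f g (q + 1) [x] := by
  obtain ⟨a, ha⟩ : ∃ a, a = m + q := ⟨_, rfl⟩
  obtain ⟨b, hb⟩ : ∃ b, b = n - q := ⟨_, rfl⟩
  obtain ⟨j, hj⟩ : ∃ j, q + j = 0 := ⟨-q, by omega⟩
  obtain ⟨j', hj'⟩ : ∃ j', j' + 1 = j := ⟨j - 1, by omega⟩
  obtain ⟨q', hq'⟩ : ∃ q', q' + 1 = q := ⟨q - 1, by omega⟩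
  rw [cupTermQ_eq _ _ q (a + 1) j b (by omega) hj hb,
    cupTermQ_eq _ _ q a j (b + 1) (by omega) hj (by omega),
    crossQ_eq f g q q' a j (b + 1) ha hj (by omega) hq',
    crossQ_eq f g (q + 1) q (a + 1) j' b (by omega) (by omega) (by omega) rfl]
  simp only [cupTermQ_eq f g q a j b ha hj hb]
  rw [← Finset.smul_sum, cup_leibniz_zero a b (by omega) _ _ _ x]
  rw [cup_linear (a + 1) b (evalQ M j q hj) (evalQ M j' (q + 1) (by omega)) (evalQ M j q hj)
    (zsmulAddGroupHom (-(j'.negOnePow : ℤ))) (zsmulAddGroupHom (-(m.negOnePow : ℤ))) _ _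
    (f.comp (a + 1) j' (by omega)).1 (fun X => homAdd (M.d q (q + 1)) ((g.comp b q (by omega)).1 X))
    (coboundary (a + 1) (f.comp a j (by omega)).1) (g.comp b q (by omega)).1 (fun X Y => by
      rw [tateD_comp (dual M) hm f (a + 1) a j j' rfl hj', map_sub, AddMonoidHom.sub_apply,
        evalQ_d M j j' q hj' hj, map_zsmul, AddMonoidHom.zsmul_apply]
      simp only [zsmulAddGroupHom_apply, neg_smul]
      abel)]
  rw [cup_linear a (b + 1) (evalQ M j q hj) (evalQ M j q hj) (evalQ M j q hj)
    (AddMonoidHom.id ℚ) (zsmulAddGroupHom (-(n.negOnePow : ℤ))) (f.comp a j (by omega)).1 _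
    (f.comp a j (by omega)).1
    (fun X => homAdd (M.d q' q) ((g.comp (b + 1) q' (by omega)).1 X))
    (f.comp a j (by omega)).1 (coboundary (b + 1) (g.comp b q (by omega)).1) (fun X Y => by
      rw [tateD_comp M hn g (b + 1) b q q' rfl hq', map_sub, map_zsmul]
      simp only [zsmulAddGroupHom_apply, AddMonoidHom.id_apply, neg_smul]
      abel)]
  simp only [zsmulAddGroupHom_apply, AddMonoidHom.id_apply, neg_smul, smul_add, smul_neg,
    smul_smul, sgn_mul]
  rw [sgn_even (n * (a + 1) + j') (m + (n + 1) * (a + 1)) ⟨-q - m - 1, by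
      rw [show j' = -q - 1 by omega, ha]; ring⟩,
    sgn_odd (n * (a + 1) + m) (n * a) ⟨-1, by
      rw [show m = -1 - n by omega]; ring⟩,
    sgn_even (m + n' * a) (m + (n + 1) * a) ⟨0, by rw [← hn]; ring⟩,
    sgn_odd (m + (n' * a + n)) (n * a + a) ⟨-1, by
      rw [← hn, show m = -1 - n by omega]; ring⟩]
  simp only [neg_smul]
  abel

lemma cupTermQZ_leibniz {m' n' : ℤ} (hm : m + 1 = m') (hn : n + 1 = n') (hmn : m + n = -1)
    (f : TateTerm (dual M) m) (g : TateTerm M n) (q : ℤ) (x : G) :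
    cupTermQZ M (tateD (dual M) m m' hm f) g q [x] +
      (m.negOnePow : ℤ) • cupTermQZ M f (tateD M n n' hn g) q [x] =
      QuotientAddGroup.mk' (AddSubgroup.zmultiples (1 : ℚ)) (cupTermQ M f g q [x]) +
      insertSum (cupTermQZ M f g q) [x] + crossQZ f g q [x] - crossQZ f g (q + 1) [x] := by
  obtain ⟨a, ha⟩ : ∃ a, a = m + q - 1 := ⟨_, rfl⟩
  obtain ⟨b, hb⟩ : ∃ b, b = n - q := ⟨_, rfl⟩
  obtain ⟨j, hj⟩ : ∃ j, q + j = 1 := ⟨1 - q, by omega⟩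
  obtain ⟨j', hj'⟩ : ∃ j', j' + 1 = j := ⟨j - 1, by omega⟩
  obtain ⟨q', hq'⟩ : ∃ q', q' + 1 = q := ⟨q - 1, by omega⟩
  have hins : insertSum (cupTermQZ M f g q) [x] = ((n * a).negOnePow : ℤ) •
      insertSum (cup a b (evalQZ M j q hj) (f.comp a j (by omega)).1
        (g.comp b q (by omega)).1) [x] := by
    have h1 : cupTermQZ M f g q = ((n * a).negOnePow : ℤ) • cup a b (evalQZ M j q hj)
        (f.comp a j (by omega)).1 (g.comp b q (by omega)).1 := by
      funext L; exact cupTermQZ_eq f g q a j b ha hj hb L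
    rw [h1]
    exact congrFun (map_zsmul (insertSumHom (G := G) (A := AddCircle (1 : ℚ))) _ _) [x]
  rw [hins, cupTermQZ_eq _ _ q (a + 1) j b (by omega) hj hb,
    cupTermQZ_eq _ _ q a j (b + 1) (by omega) hj (by omega),
    cupTermQ_eq f g q (a + 1) j' b (by omega) (by omega) hb,
    crossQZ_eq f g q q' a j (b + 1) ha hj (by omega) hq',
    crossQZ_eq f g (q + 1) q (a + 1) j' b (by omega) (by omega) (by omega) rfl,
    cup_leibniz_neg_one a b (by omega)]
  rw [cup_linear₃ (a + 1) b (evalQZ M j q hj) (evalQZ M j' (q + 1) (by omega)) (evalQZ M j q hj)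
    (evalQ M j' q (by omega))
    (zsmulAddGroupHom (-(j'.negOnePow : ℤ))) (zsmulAddGroupHom (-(m.negOnePow : ℤ)))
    (QuotientAddGroup.mk' (AddSubgroup.zmultiples (1 : ℚ))) _ _
    (f.comp (a + 1) j' (by omega)).1 (fun X => homAdd (M.d q (q + 1)) ((g.comp b q (by omega)).1 X))
    (coboundary (a + 1) (f.comp a j (by omega)).1) (g.comp b q (by omega)).1
    (f.comp (a + 1) j' (by omega)).1 (g.comp b q (by omega)).1 (fun X Y => by
      rw [tateD_comp (dual M) hm f (a + 1) a j j' rfl hj', map_sub, AddMonoidHom.sub_apply,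
        evalQZ_d M j j' q hj' hj, map_zsmul, AddMonoidHom.zsmul_apply]
      simp only [zsmulAddGroupHom_apply, neg_smul]
      abel)]
  rw [cup_linear a (b + 1) (evalQZ M j q hj) (evalQZ M j q hj) (evalQZ M j q hj)
    (AddMonoidHom.id _) (zsmulAddGroupHom (-(n.negOnePow : ℤ))) (f.comp a j (by omega)).1 _
    (f.comp a j (by omega)).1
    (fun X => homAdd (M.d q' q) ((g.comp (b + 1) q' (by omega)).1 X))
    (f.comp a j (by omega)).1 (coboundary (b + 1) (g.comp b q (by omega)).1) (fun X Y => by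
      rw [tateD_comp M hn g (b + 1) b q q' rfl hq', map_sub, map_zsmul]
      simp only [zsmulAddGroupHom_apply, AddMonoidHom.id_apply, neg_smul]
      abel)]
  simp only [zsmulAddGroupHom_apply, AddMonoidHom.id_apply, neg_smul, smul_add, smul_neg,
    smul_smul, sgn_mul, map_zsmul]
  rw [sgn_even (n * (a + 1) + j') (m + (n + 1) * (a + 1)) ⟨-q - m, by
      rw [show j' = -q by omega, ha]; ring⟩,
    sgn_odd (n * (a + 1) + m) (n * a) ⟨-1, by
      rw [show m = -1 - n by omega]; ring⟩,
    sgn_even (m + n' * a) (m + (n + 1) * a) ⟨0, by rw [← hn]; ring⟩,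
    sgn_odd (m + (n' * a + n)) (n * a + a) ⟨-1, by
      rw [← hn, show m = -1 - n by omega]; ring⟩]
  simp only [neg_smul]
  abel

lemma cupTermQ_map (f : TateTerm (dual M) m) (g : TateTerm M n) (q : ℤ) (s : G) (L : List G) :
    cupTermQ M f g q (L.map (s * ·)) = cupTermQ M f g q L := by
  simp only [cupTermQ, Pi.smul_apply]
  congr 1
  refine cup_map _ _ _ _ _ (Equiv.mulLeft s) (fun X Y => ?_) L
  have h1 := (f.comp (m + q) (-q) (by omega)).2.1 s X
  have h2 := (g.comp (n - q) q (by omega)).2.1 s Y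
  rw [Equiv.coe_mulLeft, h1, h2, evalQ_act]

lemma cupTermQZ_map (f : TateTerm (dual M) m) (g : TateTerm M n) (q : ℤ) (s : G) (L : List G) :
    cupTermQZ M f g q (L.map (s * ·)) = cupTermQZ M f g q L := by
  simp only [cupTermQZ, Pi.smul_apply]
  congr 1
  refine cup_map _ _ _ _ _ (Equiv.mulLeft s) (fun X Y => ?_) L
  have h1 := (f.comp (m + q - 1) (1 - q) (by omega)).2.1 s X
  have h2 := (g.comp (n - q) q (by omega)).2.1 s Y
  rw [Equiv.coe_mulLeft, h1, h2, evalQZ_act]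

lemma sum_cupTermQ (f : TateTerm (dual M) m) (g : TateTerm M n) (q : ℤ) :
    ∑ s : G, cupTermQ M f g q [s] = Fintype.card G * cupTermQ M f g q [1] := by
  have : ∀ s : G, cupTermQ M f g q [s] = cupTermQ M f g q [1] := fun s => by
    simpa using cupTermQ_map f g q s [1]
  simp [this]

lemma insertSum_cupTermQZ (f : TateTerm (dual M) m) (g : TateTerm M n) (q : ℤ) :
    insertSum (cupTermQZ M f g q) [1] = 0 := by
  have : ∀ s : G, cupTermQZ M f g q [s, 1] = cupTermQZ M f g q [1, s⁻¹] := fun s => by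
    simpa using cupTermQZ_map f g q s [1, s⁻¹]
  rw [insertSum_cons, insertSum_nil]
  simp only [this]
  rw [sub_eq_zero]
  exact Equiv.sum_comp (Equiv.inv G) (fun s => cupTermQZ M f g q [1, s])

lemma cup_eq_zero {A : Type*} [AddCommGroup A] {B : Type*} [AddCommGroup B] {C : Type*}
    [AddCommGroup C] (a b : ℤ) (β : A →+ B →+ C) (φ : List G → A) (ψ : List G → B)
    (h : ∀ y : B, y = 0) (L : List G) : cup a b β φ ψ L = 0 := by
  have hψ : ∀ X, ψ X = 0 := fun X => h _
  simp [cup, hψ]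

variable (M)

lemma IsBounded.exists_finset (hM : IsBounded M) :
    ∃ S : Finset ℤ, ∀ q ∉ S, ∀ y : M.X q, y = 0 := by
  obtain ⟨a, b, ha, hb⟩ := hM
  refine ⟨Finset.Icc a b, fun q hq y => ?_⟩
  have hz : Limits.IsZero (M.X q) := by
    by_cases h : q < a
    · exact M.isZero_of_isStrictlyGE a q h
    · refine M.isZero_of_isStrictlyLE b q ?_
      by_contra h'
      exact hq (Finset.mem_Icc.2 ⟨by omega, by omega⟩)
  have h1 : homAdd (𝟙 (M.X q)) y = y := rfl
  rw [← h1, hz.eq_of_src (𝟙 (M.X q)) 0]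
  rfl

variable {M}

lemma cupTermQ_eq_zero (f : TateTerm (dual M) m) (g : TateTerm M n) (q : ℤ)
    (h : ∀ y : M.X q, y = 0) (L : List G) : cupTermQ M f g q L = 0 := by
  simp only [cupTermQ, Pi.smul_apply, cup_eq_zero _ _ _ _ _ h, smul_zero]

lemma cupTermQZ_eq_zero (f : TateTerm (dual M) m) (g : TateTerm M n) (q : ℤ)
    (h : ∀ y : M.X q, y = 0) (L : List G) : cupTermQZ M f g q L = 0 := by
  simp only [cupTermQZ, Pi.smul_apply, cup_eq_zero _ _ _ _ _ h, smul_zero]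

lemma crossQ_eq_zero (f : TateTerm (dual M) m) (g : TateTerm M n) (q : ℤ)
    (h : ∀ y : M.X q, y = 0) (L : List G) : crossQ f g q L = 0 := by
  simp only [crossQ, cup_eq_zero _ _ _ _ _ h, smul_zero]

lemma crossQZ_eq_zero (f : TateTerm (dual M) m) (g : TateTerm M n) (q : ℤ)
    (h : ∀ y : M.X q, y = 0) (L : List G) : crossQZ f g q L = 0 := by
  simp only [crossQZ, cup_eq_zero _ _ _ _ _ h, smul_zero]

lemma finite_support {C : Type*} [AddCommGroup C] (S : Finset ℤ) (F : ℤ → C)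
    (h : ∀ q ∉ S, F q = 0) : (Function.support F).Finite :=
  S.finite_toSet.subset fun q hq => by
    by_contra h'
    exact hq (h q h')

/-- The sum over all degrees of a difference `E q - E (q + 1)` vanishes. -/
lemma finsum_sub_shift {C : Type*} [AddCommGroup C] (E : ℤ → C)
    (h : (Function.support E).Finite) : ∑ᶠ q : ℤ, (E q - E (q + 1)) = 0 := by
  have h2 : (Function.support fun q : ℤ => E (q + 1)).Finite :=
    h.preimage (f := fun q : ℤ => q + 1) (add_left_injective 1).injOn
  rw [finsum_sub_distrib h h2, sub_eq_zero]
  exact (finsum_comp_equiv (Equiv.addRight (1 : ℤ))).symm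

/-- The pairing is a map of complexes `RΓ̂(G, M^∨) ⊗ RΓ̂(G, M) → ℚ/ℤ`. -/
lemma pairing_leibniz (hM : IsBounded M) {m' n' : ℤ} (hm : m + 1 = m') (hn : n + 1 = n')
    (hmn : m + n = -1) (f : TateTerm (dual M) m) (g : TateTerm M n) :
    pairing M (tateD (dual M) m m' hm f) g +
      (m.negOnePow : ℤ) • pairing M f (tateD M n n' hn g) = 0 := by
  obtain ⟨S, hS⟩ := hM.exists_finset
  have f1 : ∀ {m n : ℤ} (f : TateTerm (dual M) m) (g : TateTerm M n),
      (Function.support fun q => cupTermQ M f g q [1]).Finite := fun f g =>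
    finite_support S _ fun q hq => cupTermQ_eq_zero f g q (hS q hq) _
  have f2 : ∀ {m n : ℤ} (f : TateTerm (dual M) m) (g : TateTerm M n),
      (Function.support fun q => cupTermQZ M f g q [1]).Finite := fun f g =>
    finite_support S _ fun q hq => cupTermQZ_eq_zero f g q (hS q hq) _
  have f3 : (Function.support fun q => crossQ f g q [1]).Finite :=
    finite_support S _ fun q hq => crossQ_eq_zero f g q (hS q hq) _
  have f4 : (Function.support fun q => crossQZ f g q [1]).Finite :=
    finite_support S _ fun q hq => crossQZ_eq_zero f g q (hS q hq) _
  have f5 : ∀ {C : Type} [AddCommGroup C] (E : ℤ → C), (Function.support E).Finite →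
      (Function.support fun q => E q - E (q + 1)).Finite := fun E h => by
    have h2 : (Function.support fun q : ℤ => E (q + 1)).Finite :=
      h.preimage (f := fun q : ℤ => q + 1) (add_left_injective 1).injOn
    exact (h.union h2).subset (Function.support_sub _ _)
  have key1 : ∑ᶠ q, cupTermQ M (tateD (dual M) m m' hm f) g q [1] +
      (m.negOnePow : ℤ) • ∑ᶠ q, cupTermQ M f (tateD M n n' hn g) q [1] =
      Fintype.card G * ∑ᶠ q, cupTermQ M f g q [1] := by
    rw [smul_finsum' _ (f1 _ _), ← finsum_add_distrib (f1 _ _)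
      (finite_support S _ fun q hq => by rw [cupTermQ_eq_zero _ _ q (hS q hq), smul_zero])]
    simp only [cupTermQ_leibniz hm hn hmn, sum_cupTermQ, add_sub_assoc]
    rw [finsum_add_distrib _ (f5 _ f3), finsum_sub_shift _ f3, add_zero, mul_finsum' _ _ (f1 f g)]
    exact (f1 f g).subset fun q hq h0 => hq (by simp only [h0, mul_zero])
  have key2 : ∑ᶠ q, cupTermQZ M (tateD (dual M) m m' hm f) g q [1] +
      (m.negOnePow : ℤ) • ∑ᶠ q, cupTermQZ M f (tateD M n n' hn g) q [1] =
      QuotientAddGroup.mk' (AddSubgroup.zmultiples (1 : ℚ)) (∑ᶠ q, cupTermQ M f g q [1]) := by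
    rw [smul_finsum' _ (f2 _ _), ← finsum_add_distrib (f2 _ _)
      (finite_support S _ fun q hq => by rw [cupTermQZ_eq_zero _ _ q (hS q hq), smul_zero])]
    simp only [cupTermQZ_leibniz hm hn hmn, insertSum_cupTermQZ, add_sub_assoc, add_zero]
    rw [finsum_add_distrib _ (f5 _ f4), finsum_sub_shift _ f4, add_zero,
      AddMonoidHom.map_finsum _ (f1 f g)]
    exact (f1 f g).subset fun q hq h0 => hq (by simp only [h0, map_zero])
  have hG : (Fintype.card G : ℚ) ≠ 0 := by simp
  have hc : ∀ (c : ℤ) (r : ℚ), ((c • r : ℚ) : AddCircle (1 : ℚ)) = c • (r : AddCircle (1 : ℚ)) :=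
    fun c r => map_zsmul (QuotientAddGroup.mk' (AddSubgroup.zmultiples (1 : ℚ))) c r
  simp only [pairing, smul_sub]
  rw [← hc, sub_add_sub_comm, key2, ← AddCircle.coe_add, ← smul_div_assoc, ← add_div, key1,
    mul_div_cancel_left₀ _ hG]
  exact sub_self _

lemma cup_add_left {A : Type*} [AddCommGroup A] {B : Type*} [AddCommGroup B] {C : Type*}
    [AddCommGroup C] (a b : ℤ) (β : A →+ B →+ C) (φ φ' : List G → A) (ψ : List G → B) :
    cup a b β (φ + φ') ψ = cup a b β φ ψ + cup a b β φ' ψ := by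
  funext L
  exact cup_linear a b β β β (AddMonoidHom.id _) (AddMonoidHom.id _) _ _ _ _ _ _
    (fun X Y => by simp) L

lemma cup_add_right {A : Type*} [AddCommGroup A] {B : Type*} [AddCommGroup B] {C : Type*}
    [AddCommGroup C] (a b : ℤ) (β : A →+ B →+ C) (φ : List G → A) (ψ ψ' : List G → B) :
    cup a b β φ (ψ + ψ') = cup a b β φ ψ + cup a b β φ ψ' := by
  funext L
  exact cup_linear a b β β β (AddMonoidHom.id _) (AddMonoidHom.id _) _ _ _ _ _ _
    (fun X Y => by simp) L

lemma pairing_add_left (hM : IsBounded M) (f f' : TateTerm (dual M) m) (g : TateTerm M n) :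
    pairing M (f + f') g = pairing M f g + pairing M f' g := by
  obtain ⟨S, hS⟩ := hM.exists_finset
  have e1 : ∀ q, cupTermQ M (f + f') g q [1] = cupTermQ M f g q [1] + cupTermQ M f' g q [1] :=
    fun q => by
      simp only [cupTermQ, TateTerm.comp, Pi.add_apply, AddSubgroup.coe_add, cup_add_left,
        Pi.smul_apply, smul_add]
  have e2 : ∀ q, cupTermQZ M (f + f') g q [1] = cupTermQZ M f g q [1] + cupTermQZ M f' g q [1] :=
    fun q => by
      simp only [cupTermQZ, TateTerm.comp, Pi.add_apply, AddSubgroup.coe_add, cup_add_left,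
        Pi.smul_apply, smul_add]
  simp only [pairing, e1, e2]
  rw [finsum_add_distrib (finite_support S _ fun q hq => cupTermQ_eq_zero f g q (hS q hq) _)
      (finite_support S _ fun q hq => cupTermQ_eq_zero f' g q (hS q hq) _),
    finsum_add_distrib (finite_support S _ fun q hq => cupTermQZ_eq_zero f g q (hS q hq) _)
      (finite_support S _ fun q hq => cupTermQZ_eq_zero f' g q (hS q hq) _),
    add_div, AddCircle.coe_add]
  abel

lemma pairing_add_right (hM : IsBounded M) (f : TateTerm (dual M) m) (g g' : TateTerm M n) :
    pairing M f (g + g') = pairing M f g + pairing M f g' := by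
  obtain ⟨S, hS⟩ := hM.exists_finset
  have e1 : ∀ q, cupTermQ M f (g + g') q [1] = cupTermQ M f g q [1] + cupTermQ M f g' q [1] :=
    fun q => by
      simp only [cupTermQ, TateTerm.comp, Pi.add_apply, AddSubgroup.coe_add, cup_add_right,
        Pi.smul_apply, smul_add]
  have e2 : ∀ q, cupTermQZ M f (g + g') q [1] = cupTermQZ M f g q [1] + cupTermQZ M f g' q [1] :=
    fun q => by
      simp only [cupTermQZ, TateTerm.comp, Pi.add_apply, AddSubgroup.coe_add, cup_add_right,
        Pi.smul_apply, smul_add]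
  simp only [pairing, e1, e2]
  rw [finsum_add_distrib (finite_support S _ fun q hq => cupTermQ_eq_zero f g q (hS q hq) _)
      (finite_support S _ fun q hq => cupTermQ_eq_zero f g' q (hS q hq) _),
    finsum_add_distrib (finite_support S _ fun q hq => cupTermQZ_eq_zero f g q (hS q hq) _)
      (finite_support S _ fun q hq => cupTermQZ_eq_zero f g' q (hS q hq) _),
    add_div, AddCircle.coe_add]
  abel

end Leibniz

section DualityMap

variable {G : Type u} [Group G] [Fintype G]

/-- The adjoint map `RΓ̂(G, M^∨) → RHom(RΓ̂(G, M), ℚ/ℤ)`, `f ↦ (g ↦ ⟨f, g⟩)`, of the pairing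
`RΓ̂(G, M^∨) ⊗ RΓ̂(G, M) → ℚ/ℤ`. -/
def dualityMap (M : CochainComplex (Rep.{w} ℤ G) ℤ) (hM : IsBounded M) :
    tateComplex (dual M) ⟶ pontryaginDual (tateComplex M) where
  f m := AddCommGrpCat.ofHom (AddMonoidHom.mk'
    (fun f : TateTerm (dual M) m => AddMonoidHom.mk'
      (fun g : TateTerm M (-m) => pairing M f g) (pairing_add_right hM f))
    (fun f f' => AddMonoidHom.ext fun g => pairing_add_left hM f f' g))
  comm' m m' h := by
    refine AddCommGrpCat.hom_ext (AddMonoidHom.ext fun f => AddMonoidHom.ext fun g => ?_)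
    have h' : m + 1 = m' := h
    have key := pairing_leibniz hM h' (show -m' + 1 = -m by omega) (by omega) f g
    have e1 : (tateComplex (dual M)).d m m' = AddCommGrpCat.ofHom (tateD (dual M) m m' h') :=
      dif_pos h'
    have e2 : (tateComplex M).d (-m') (-m) =
        AddCommGrpCat.ofHom (tateD M (-m') (-m) (by omega)) := dif_pos (by omega)
    have e3 : ((m + 1).negOnePow : ℤ) • pairing M f (tateD M (-m') (-m) (by omega) g) =
        pairing M (tateD (dual M) m m' h' f) g := by
      rw [Int.negOnePow_succ, Units.val_neg, neg_smul, eq_comm, ← add_eq_zero_iff_eq_neg]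
      exact key
    rw [e1]
    refine Eq.trans ?_ e3
    change ((m + 1).negOnePow : ℤ) • pairing M f (((tateComplex M).d (-m') (-m)).hom g) = _
    rw [e2]
    rfl

end DualityMap

end

end TateDuality

/-!
The duality map is a quasi-isomorphism because, on the part of `RΓ̂(G, M^∨)` that carries the
cohomology, it is an isomorphism of complexes.

With `ℤ` resolved by `ℚ → ℚ/ℤ`, the dual `M^∨` is an extension of `Hom(M, ℚ)` by
`Hom(M, ℚ/ℤ)[-1]`.  The cochains with values in `Hom(M, ℚ)` are acyclic: a standard contraction of
the complete resolution, averaged over `G`, is a contracting homotopy on cochains with values in a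
rational vector space (`coboundary_contraction`).  Hence every cocycle of `RΓ̂(G, M^∨)` is
cohomologous to one without rational components (`sub_tateD_tateContraction_mem`), that is, to one
in the subcomplex `RΓ̂(G, Hom(M, ℚ/ℤ)[-1])`, called `torsionCochains`.

On this subcomplex only the cup product into total degree `-1` contributes to the pairing.  The
terms `P_p` and `P_(-1-p)` of the standard complete resolution are dual to each other, their bases
being indexed by tuples of the same length, and this cup product is the resulting perfect pairing of
`Hom_G(P_(-1-p), Hom(M^q, ℚ/ℤ))` with `Hom_G(P_p, M^q)`: pairing with the cochain supported on the
orbit of a tuple `R` is evaluation at the reversed tuple (`cup_orbitCochain`).  As these orbit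
cochains generate `RΓ̂(G, M)` for bounded `M` (`tateTerm_hom_ext`), the subcomplex is mapped
bijectively to `Hom(RΓ̂(G, M), ℚ/ℤ)`; the inverse is `representingCochain`.  A diagram chase
(`quasiIso_of_bijOn`) combines the two facts.
-/

namespace TateDuality

/-! ### A criterion for quasi-isomorphisms of complexes of abelian groups -/

lemma homologyπ_eq_zero_iff (S : ShortComplex AddCommGrpCat.{w}) (z : S.cycles) :
    S.homologyπ z = 0 ↔ ∃ x : S.X₁, S.f x = S.iCycles z := by
  have hex := (ShortComplex.ab_exact_iff _).1
    (ShortComplex.exact_of_g_is_cokernel (.mk _ _ S.toCycles_comp_homologyπ) S.homologyIsCokernel)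
  have hi : Function.Injective S.iCycles := (AddCommGrpCat.mono_iff_injective _).1 inferInstance
  refine ⟨fun h => ?_, fun ⟨x, hx⟩ => ?_⟩
  · obtain ⟨x, hx⟩ := hex z h
    refine ⟨x, ?_⟩
    rw [← hx, ← ConcreteCategory.comp_apply, S.toCycles_i]
  · obtain rfl : S.toCycles x = z := hi (by
      rw [← ConcreteCategory.comp_apply, S.toCycles_i, hx])
    rw [← ConcreteCategory.comp_apply, S.toCycles_comp_homologyπ]
    rfl

lemma shortComplex_quasiIso_of_elements {S T : ShortComplex AddCommGrpCat.{w}} (φ : S ⟶ T)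
    (hinj : ∀ x : S.X₂, S.g x = 0 → (∃ y : T.X₁, T.f y = φ.τ₂ x) → ∃ z : S.X₁, S.f z = x)
    (hsurj : ∀ y : T.X₂, T.g y = 0 → ∃ x : S.X₂, S.g x = 0 ∧ φ.τ₂ x = y) :
    ShortComplex.QuasiIso φ := by
  have hπS : Function.Surjective S.homologyπ :=
    (AddCommGrpCat.epi_iff_surjective _).1 inferInstance
  have hπT : Function.Surjective T.homologyπ :=
    (AddCommGrpCat.epi_iff_surjective _).1 inferInstance
  have hiT : Function.Injective T.iCycles := (AddCommGrpCat.mono_iff_injective _).1 inferInstance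
  have nat : ∀ z, ShortComplex.homologyMap φ (S.homologyπ z) =
      T.homologyπ (ShortComplex.cyclesMap φ z) := fun z => by
    rw [← ConcreteCategory.comp_apply, ShortComplex.homologyπ_naturality,
      ConcreteCategory.comp_apply]
  have nat' : ∀ z, T.iCycles (ShortComplex.cyclesMap φ z) = φ.τ₂ (S.iCycles z) := fun z => by
    rw [← ConcreteCategory.comp_apply, ShortComplex.cyclesMap_i, ConcreteCategory.comp_apply]
  have cyc : ∀ (U : ShortComplex AddCommGrpCat.{w}) (z : U.cycles), U.g (U.iCycles z) = 0 :=
    fun U z => by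
      rw [← ConcreteCategory.comp_apply, U.iCycles_g]
      rfl
  rw [ShortComplex.quasiIso_iff]
  have : Mono (ShortComplex.homologyMap φ) := by
    rw [AddCommGrpCat.mono_iff_injective]
    refine (injective_iff_map_eq_zero (ShortComplex.homologyMap φ).hom).2 fun c hc => ?_
    obtain ⟨z, rfl⟩ := hπS c
    have hc' : T.homologyπ (ShortComplex.cyclesMap φ z) = 0 := (nat z).symm.trans hc
    rw [homologyπ_eq_zero_iff, nat'] at hc'
    exact (homologyπ_eq_zero_iff S z).2 (hinj _ (cyc S z) hc')
  have : Epi (ShortComplex.homologyMap φ) := by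
    rw [AddCommGrpCat.epi_iff_surjective]
    intro c
    obtain ⟨z, rfl⟩ := hπT c
    obtain ⟨x, hx, hxz⟩ := hsurj _ (cyc T z)
    refine ⟨S.homologyπ (S.abCyclesIso.inv ⟨x, hx⟩), ?_⟩
    rw [nat]
    congr 1
    apply hiT
    rw [nat', ShortComplex.abCyclesIso_inv_apply_iCycles, hxz]
  exact isIso_of_mono_of_epi _

/-- Let `K` be a graded subgroup of `A` that is mapped bijectively to `B`, such that every cocycle
of `A` is cohomologous to one in `K`, and such that `K` is stable under the differential.  Then
`A → B` is a quasi-isomorphism. -/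
lemma quasiIso_of_bijOn {A B : CochainComplex AddCommGrpCat.{w} ℤ} (φ : A ⟶ B)
    (K : ∀ n : ℤ, AddSubgroup (A.X n))
    (hd : ∀ n, ∀ x ∈ K n, A.d n (n + 1) x ∈ K (n + 1))
    (hK : ∀ n (x : A.X n), A.d n (n + 1) x = 0 → ∃ z, x - A.d (n - 1) n z ∈ K n)
    (hinj : ∀ n, ∀ x ∈ K n, φ.f n x = 0 → x = 0)
    (hsurj : ∀ n (y : B.X n), ∃ x ∈ K n, φ.f n x = y) : QuasiIso φ := by
  have comm : ∀ i j (x : A.X i), B.d i j (φ.f i x) = φ.f j (A.d i j x) := fun i j x => by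
    rw [← ConcreteCategory.comp_apply, φ.comm, ConcreteCategory.comp_apply]
  refine ⟨fun n => (_root_.quasiIsoAt_iff' φ (n - 1) n (n + 1) (by simp)
    (by simp)).2 (shortComplex_quasiIso_of_elements _ ?_ ?_)⟩
  · intro x hx ⟨y, hy⟩
    change A.X n at x
    change B.X (n - 1) at y
    change A.d n (n + 1) x = 0 at hx
    change B.d (n - 1) n y = φ.f n x at hy
    change ∃ z : A.X (n - 1), A.d (n - 1) n z = x
    obtain ⟨z, hz⟩ := hK n x hx
    obtain ⟨k, hk, hky⟩ := hsurj (n - 1) (y - φ.f (n - 1) z)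
    have hdk : A.d (n - 1) n k ∈ K n := by
      have := hd (n - 1) k hk
      rwa [sub_add_cancel] at this
    have h0 := hinj n _ (sub_mem hz hdk) (by
      rw [map_sub, map_sub, ← comm, ← comm, hky, map_sub, hy]
      abel)
    exact ⟨z + k, by rw [map_add]; rw [sub_sub, sub_eq_zero] at h0; exact h0.symm⟩
  · intro y hy
    change B.X n at y
    change B.d n (n + 1) y = 0 at hy
    obtain ⟨x, hx, rfl⟩ := hsurj n y
    exact ⟨x, hinj (n + 1) _ (hd n x hx) ((comm n (n + 1) x).symm.trans hy), rfl⟩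

/-! ### A contraction of the cochains with rational coefficients -/

section Contraction

variable {G : Type u} [Fintype G] {W : Type*} [AddCommGroup W] [Module ℚ W]

/-- The contraction of the complex of cochains with values in a rational vector space, from degree
`p` to degree `p - 1`: up to a rational factor it sums over the first entry if `p > 0`, forgets the
first entry if `p < 0`, and joins the two halves of the resolution by a norm if `p = 0`.  In degree
`0` the factor is `1/|G|²`, because the coboundary to degree `0` sums the constant result over `G`
once more and has to return the mean value. -/
noncomputable def contraction (p : ℤ) (F : List G → W) (L : List G) : W :=
  if 0 < p then (Fintype.card G : ℚ)⁻¹ • ∑ t : G, F (t :: L)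
  else if p = 0 then
    (if L.length = 1 then (Fintype.card G : ℚ)⁻¹ • (Fintype.card G : ℚ)⁻¹ • ∑ t : G, F [t] else 0)
  else match L with
    | [] => 0
    | _ :: L => (Fintype.card G : ℚ)⁻¹ • F L

lemma contraction_of_pos {p : ℤ} (hp : 0 < p) (F : List G → W) (L : List G) :
    contraction p F L = (Fintype.card G : ℚ)⁻¹ • ∑ t : G, F (t :: L) := by
  unfold contraction
  rw [if_pos hp]

lemma contraction_smul (p : ℤ) (c : ℤ) (F : List G → W) (L : List G) :
    contraction p (c • F) L = c • contraction p F L := by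
  simp only [contraction, Pi.smul_apply, ← Finset.smul_sum]
  split_ifs
  · rw [smul_comm]
  · rw [smul_comm _ c, smul_comm _ c]
  · rw [smul_zero]
  · cases L with
    | nil => rw [smul_zero]
    | cons g L => rw [smul_comm]

lemma contraction_add (p : ℤ) (F F' : List G → W) (L : List G) :
    contraction p (fun X => F X + F' X) L = contraction p F L + contraction p F' L := by
  simp only [contraction, Finset.sum_add_distrib]
  split_ifs
  · rw [smul_add]
  · rw [smul_add, smul_add]
  · rw [add_zero]
  · cases L with
    | nil => rw [add_zero]
    | cons g L => exact smul_add _ _ _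

lemma contraction_map (p : ℤ) (e : G ≃ G) (F : List G → W) (L : List G) :
    contraction p F (L.map e) = contraction p (fun X => F (X.map e)) L := by
  simp only [contraction, List.length_map, List.map_cons, List.map_nil]
  rw [← e.sum_comp (fun s => F [s]), ← e.sum_comp (fun s => F (s :: L.map e))]
  cases L <;> rfl

lemma contraction_support (p q : ℤ) (h : p + 1 = q) (F : List G → W)
    (hF : ∀ L : List G, L.length ≠ len q → F L = 0) (L : List G) (hL : L.length ≠ len p) :
    contraction q F L = 0 := by
  simp only [len] at hF hL
  unfold contraction
  split_ifs with h1 h2 h3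
  · rw [Finset.sum_eq_zero, smul_zero]
    intro t _
    apply hF
    rw [List.length_cons]
    split_ifs at * <;> omega
  · exfalso; apply hL; rw [if_neg (by omega)]; omega
  · rfl
  · cases L with
    | nil => rfl
    | cons g L =>
      rw [List.length_cons] at hL
      simp only
      rw [hF, smul_zero]
      split_ifs at * <;> omega

lemma insertSum_smul_rat (c : ℚ) (F : List G → W) (L : List G) :
    insertSum (c • F) L = c • insertSum F L :=
  insertSum_comp (LinearMap.lsmul ℚ W c).toAddMonoidHom F L

/-- `contraction` is a contracting homotopy of the complex of cochains. -/
lemma coboundary_contraction [Nonempty G] (p : ℤ) (F : List G → W)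
    (hF : ∀ L : List G, L.length ≠ len p → F L = 0) (L : List G) :
    coboundary p (contraction p F) L + contraction (p + 1) (coboundary (p + 1) F) L = F L := by
  have hG : (Fintype.card G : ℚ) ≠ 0 := by simp
  have hc : ∀ x : W, ∑ _t : G, x = (Fintype.card G : ℚ) • x := fun x => by
    simp [Nat.cast_smul_eq_nsmul]
  rcases lt_trichotomy p 0 with hp | rfl | hp
  -- For `p = -1`, the coboundary to degree `0` is the norm, which is `insertSum F []`, so that the
  -- formula for `p < -1` persists.
  · have e1 : contraction (p + 1) (coboundary (p + 1) F) L =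
        match L with
        | [] => 0
        | _ :: L => (Fintype.card G : ℚ)⁻¹ • insertSum F L := by
      rcases eq_or_lt_of_le (show p ≤ -1 by omega) with rfl | hp'
      · match L with
        | [] => simp [contraction]
        | [g] =>
          simp only [contraction, coboundary, lt_irrefl, if_true, if_false, Int.reduceNeg,
            Int.reduceAdd, List.length_cons, List.length_nil, zero_add, insertSum_nil]
          rw [hc, inv_smul_smul₀ hG]
        | g :: h :: L =>
          have : insertSum F (h :: L) = 0 := Finset.sum_eq_zero fun i hi => by
            rw [Finset.sum_eq_zero, smul_zero]
            intro s _
            apply hF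
            have := Finset.mem_range.1 hi
            rw [List.length_insertIdx, if_pos (by omega)]
            simp [len]
          simp [contraction, this]
      · cases L with
        | nil => simp [contraction, show ¬ 0 < p + 1 by omega]
        | cons g L =>
          rw [contraction, if_neg (by omega), if_neg (by omega)]
          simp only
          rw [coboundary, if_neg (by omega), if_neg (by omega)]
    have e2 : ∀ g : G, (fun X => contraction p F (g :: X)) = (Fintype.card G : ℚ)⁻¹ • F :=
      fun g => by
        funext X
        rw [contraction, if_neg (by omega), if_neg (by omega)]
        rfl
    have e3 : ∀ (g : G) (X : List G), contraction p F (g :: X) = (Fintype.card G : ℚ)⁻¹ • F X :=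
      fun g X => congrFun (e2 g) X
    rw [e1, coboundary, if_neg (by omega), if_neg (by omega)]
    cases L with
    | nil =>
      rw [insertSum_nil]
      simp only [e3, hc, smul_inv_smul₀ hG, add_zero]
    | cons g L =>
      rw [insertSum_cons, e2, insertSum_smul_rat]
      simp only [e3, hc, smul_inv_smul₀ hG, sub_add_cancel]
  · match L with
    | [] =>
      rw [hF [] (by simp [len])]
      simp [coboundary, contraction, faceSum_cons, faceSum_nil, hF [] (by simp [len])]
    | [g] =>
      simp [coboundary, contraction, faceSum_cons, faceSum_nil, hc, smul_inv_smul₀ hG,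
        Finset.sum_sub_distrib, smul_sub, inv_smul_smul₀ hG]
    | g :: h :: L =>
      rw [hF (g :: h :: L) (by simp [len])]
      simp only [coboundary, contraction, List.length_cons, lt_irrefl, if_false, if_true, zero_add,
        zero_lt_one]
      rw [if_neg (by omega), zero_add, Finset.sum_eq_zero, smul_zero]
      refine fun t _ => Finset.sum_eq_zero fun i hi => ?_
      rw [hF, smul_zero]
      have := Finset.mem_range.1 hi
      rw [List.length_eraseIdx_of_lt this]
      simp [len]
  · have e1 : contraction p F = fun X => (Fintype.card G : ℚ)⁻¹ • ∑ t : G, F (t :: X) := by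
      funext X; rw [contraction_of_pos hp]
    have e2 : faceSum (fun X => (Fintype.card G : ℚ)⁻¹ • ∑ t : G, F (t :: X)) L =
        (Fintype.card G : ℚ)⁻¹ • ∑ t : G, faceSum (fun X => F (t :: X)) L := by
      simp only [faceSum]
      rw [Finset.sum_comm, Finset.smul_sum]
      refine Finset.sum_congr rfl fun i _ => ?_
      rw [smul_comm, Finset.smul_sum]
    rw [coboundary, if_pos hp, contraction_of_pos (by omega), e1, e2, ← smul_add,
      ← Finset.sum_add_distrib]
    have e3 : ∀ t : G, faceSum (fun X => F (t :: X)) L + coboundary (p + 1) F (t :: L) = F L :=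
      fun t => by rw [coboundary, if_pos (by omega), faceSum_cons]; abel
    simp only [e3, hc, inv_smul_smul₀ hG]

end Contraction

/-! ### Cochains whose rational components vanish -/

section Torsion

variable {G : Type u} [Group G]

/-- The cochains in `RΓ̂(G, M^∨)` with vanishing components in `Hom(M^q, ℚ)`: the subcomplex
`RΓ̂(G, Hom(M, ℚ/ℤ)[-1])`. -/
def torsionCochains (M : CochainComplex (Rep.{w} ℤ G) ℤ) (m : ℤ) :
    AddSubgroup (TateTerm (dual M) m) where
  carrier := {f | ∀ (p j : ℤ) (h : p + j = m) (q : ℤ) (hq : q + j = 0) (L : List G) (y : M.X q),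
    evalQ M j q hq ((f.comp p j h).1 L) y = 0}
  zero_mem' _ _ _ _ _ _ _ := rfl
  add_mem' {f f'} hf hf' p j h q hq L y := by
    change evalQ M j q hq ((f.comp p j h).1 L + (f'.comp p j h).1 L) y = 0
    rw [map_add, AddMonoidHom.add_apply, hf, hf', add_zero]
  neg_mem' {f} hf p j h q hq L y := by
    change evalQ M j q hq (-(f.comp p j h).1 L) y = 0
    rw [map_neg, AddMonoidHom.neg_apply, hf, neg_zero]

variable [Fintype G] {M : CochainComplex (Rep.{w} ℤ G) ℤ}

/-- The rational component of the differential of `RΓ̂(G, M^∨)` in `Hom(M^q, ℚ)` depends on rational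
components only. -/
lemma evalQ_tateD {n n' : ℤ} (h : n + 1 = n') (f : TateTerm (dual M) n) (p p' j j' q : ℤ)
    (hp : p' + 1 = p) (hj : j' + 1 = j) (hpj : p + j = n') (hq : q + j = 0) (L : List G)
    (y : M.X q) :
    evalQ M j q hq (((tateD (dual M) n n' h f).comp p j hpj).1 L) y =
      -((j'.negOnePow : ℤ) • evalQ M j' (q + 1) (by omega) ((f.comp p j' (by omega)).1 L)
        (homAdd (M.d q (q + 1)) y)) -
      (n.negOnePow : ℤ) • coboundary p
        (fun X => evalQ M j q hq ((f.comp p' j (by omega)).1 X) y) L := by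
  rw [tateD_comp _ h f p p' j j' hp hj, map_sub, AddMonoidHom.sub_apply, evalQ_d M j j' q hj hq,
    map_zsmul, AddMonoidHom.zsmul_apply]
  congr 2
  exact (coboundary_comp ((AddMonoidHom.eval y).comp (evalQ M j q hq)) p _ L).symm

lemma tateD_mem_torsionCochains {m m' : ℤ} (h : m + 1 = m') {f : TateTerm (dual M) m}
    (hf : f ∈ torsionCochains M m) : tateD (dual M) m m' h f ∈ torsionCochains M m' := by
  intro p j hpj q hq L y
  rw [evalQ_tateD h f p (p - 1) j (j - 1) q (by omega) (by omega), hf]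
  have : (fun X => evalQ M j q hq ((f.comp (p - 1) j (by omega)).1 X) y) = 0 :=
    funext fun X => hf _ _ _ _ _ _ _
  rw [this]
  have h0 : coboundary p (0 : List G → ℚ) = 0 := (coboundaryHom p).map_zero
  simp [h0]

variable (M)

/-- The contraction, applied to the components in `Hom(M^q, ℚ)` of a cochain with values in
`M^∨`. -/
noncomputable def dualContraction (p q j : ℤ) (h : p + 1 = q)
    (F : tateCochains ((dual M).X j) q) : tateCochains ((dual M).X j) p :=
  ⟨fun L => show DualTerm M j from
      (fun r => AddMonoidHom.mk' (fun y => contraction q (fun X => evalQ M j r r.2 (F.1 X) y) L)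
        (fun y y' => by simp only [map_add, contraction_add]), 0),
    fun g L => by
      refine Prod.ext (funext fun r => AddMonoidHom.ext fun y => ?_) ?_
      · change contraction q (fun X => evalQ M j r r.2 (F.1 X) y) (L.map (g * ·)) =
          contraction q (fun X => evalQ M j r r.2 (F.1 X) ((M.X r).ρ g⁻¹ y)) L
        refine (contraction_map q (Equiv.mulLeft g) _ L).trans (congrArg (contraction q · L) ?_)
        funext X
        rw [Equiv.coe_mulLeft, F.2.1 g X, ← evalQ_act M j r r.2 (F.1 X) _ g]
        simp
      · rfl,
    fun L hL => by
      refine Prod.ext (funext fun r => AddMonoidHom.ext fun y => ?_) rfl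
      exact contraction_support p q h _ (fun X hX => by rw [F.2.2 X hX]; rfl) L hL⟩

/-- The contraction on the rational part of `RΓ̂(G, M^∨)`.  The sign makes it anticommute with
the part of the differential that comes from `M^∨`. -/
noncomputable def tateContraction (m m' : ℤ) (h : m' + 1 = m) (f : TateTerm (dual M) m) :
    TateTerm (dual M) m' :=
  fun ⟨(p, j), hp⟩ => (m.negOnePow : ℤ) •
    dualContraction M p (p + 1) j rfl (f.comp (p + 1) j (by dsimp only at hp; omega))

variable {M}

lemma evalQ_tateContraction {m m' : ℤ} (h : m' + 1 = m) (f : TateTerm (dual M) m)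
    (p p' j q : ℤ) (hp : p' + 1 = p) (hpj : p' + j = m') (hq : q + j = 0) (L : List G)
    (y : M.X q) :
    evalQ M j q hq (((tateContraction M m m' h f).comp p' j hpj).1 L) y =
      (m.negOnePow : ℤ) •
        contraction p (fun X => evalQ M j q hq ((f.comp p j (by omega)).1 X) y) L := by
  subst hp
  change evalQ M j q hq ((m.negOnePow : ℤ) • (dualContraction M p' (p' + 1) j rfl
    (f.comp (p' + 1) j (by omega))).1 L) y = _
  rw [map_zsmul, AddMonoidHom.zsmul_apply]
  rfl

/-- The rational part of `RΓ̂(G, M^∨)` is acyclic: a cocycle is cohomologous to one whose rational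
components vanish. -/
lemma sub_tateD_tateContraction_mem {m m' m'' : ℤ} (h : m' + 1 = m) (h' : m + 1 = m'')
    (f : TateTerm (dual M) m) (hf : tateD (dual M) m m'' h' f = 0) :
    f - tateD (dual M) m' m h (tateContraction M m m' h f) ∈ torsionCochains M m := by
  intro p j hpj q hq L y
  have hmm : (m.negOnePow : ℤ) * m.negOnePow = 1 := by
    rw [sgn_mul, Int.negOnePow_even _ ⟨m, rfl⟩]; rfl
  have hm' : (m'.negOnePow : ℤ) = -m.negOnePow := sgn_odd _ _ ⟨-1, by omega⟩
  obtain ⟨φ, hφ⟩ : ∃ φ : List G → ℚ, φ = fun X => evalQ M j q hq ((f.comp p j hpj).1 X) y :=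
    ⟨_, rfl⟩
  -- The cocycle condition expresses the differential of `M^∨` through the coboundary.
  have e1 : ∀ X, -(((j - 1).negOnePow : ℤ) • evalQ M (j - 1) (q + 1) (by omega)
      ((f.comp (p + 1) (j - 1) (by omega)).1 X) (homAdd (M.d q (q + 1)) y)) =
      (m.negOnePow : ℤ) • coboundary (p + 1) φ X := fun X => by
    have := evalQ_tateD h' f (p + 1) p j (j - 1) q rfl (by omega) (by omega) hq X y
    rw [hf, ← hφ] at this
    exact sub_eq_zero.1 (this.symm.trans rfl)
  have e2 : ((j - 1).negOnePow : ℤ) • evalQ M (j - 1) (q + 1) (by omega)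
      (((tateContraction M m m' h f).comp p (j - 1) (by omega)).1 L) (homAdd (M.d q (q + 1)) y) =
      -contraction (p + 1) (coboundary (p + 1) φ) L := by
    rw [evalQ_tateContraction h f (p + 1) p (j - 1) (q + 1) rfl, smul_comm, ← contraction_smul]
    have : (((j - 1).negOnePow : ℤ) • fun X => evalQ M (j - 1) (q + 1) (by omega)
        ((f.comp (p + 1) (j - 1) (by omega)).1 X) (homAdd (M.d q (q + 1)) y)) =
        (-(m.negOnePow : ℤ)) • coboundary (p + 1) φ := by
      funext X
      rw [Pi.smul_apply, Pi.smul_apply, neg_smul, ← e1 X, neg_neg]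
    rw [this, contraction_smul, smul_smul, mul_neg, hmm, neg_smul, one_smul]
  have e3 : (fun X => evalQ M j q hq
      (((tateContraction M m m' h f).comp (p - 1) j (by omega)).1 X) y) =
      (m.negOnePow : ℤ) • contraction p φ := by
    funext X
    rw [evalQ_tateContraction h f p (p - 1) j q (by omega), hφ]
    rfl
  have e4 : coboundary p ((m.negOnePow : ℤ) • contraction p φ) L =
      (m.negOnePow : ℤ) • coboundary p (contraction p φ) L :=
    congrFun (map_zsmul (coboundaryHom (G := G) (A := ℚ) p) _ _) L
  change evalQ M j q hq ((f.comp p j hpj).1 L -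
    ((tateD (dual M) m' m h (tateContraction M m m' h f)).comp p j hpj).1 L) y = 0
  rw [map_sub, AddMonoidHom.sub_apply,
    evalQ_tateD h _ p (p - 1) j (j - 1) q (by omega) (by omega), e2, e3, e4, smul_smul, hm',
    neg_mul, hmm, neg_smul, one_smul, neg_neg, sub_neg_eq_add, add_comm,
    coboundary_contraction p φ (fun X hX => by rw [hφ]; simp only [(f.comp p j hpj).2.2 X hX]; rfl)]
  rw [hφ, sub_self]

end Torsion

/-! ### Orbit cochains and the perfectness of the cup product into degree `-1` -/

section Orbit

variable {G : Type u} [Group G] [Fintype G]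

open Classical in
/-- `G` acts freely on tuples: exactly one translate of a nonempty tuple begins with `1`. -/
lemma sum_sum_ite_map_eq {C : Type*} [AddCommGroup C] {k : ℕ} {L : List G}
    (hL : L.length = k + 1) (c : C) :
    ∑ s : Fin k → G, ∑ g : G, (if L.map (g * ·) = 1 :: List.ofFn s then c else 0) = c := by
  match L with
  | [] => simp at hL
  | x :: L =>
    obtain rfl : L.length = k := by simpa using hL
    rw [Finset.sum_eq_single fun i => x⁻¹ * L.get i, Finset.sum_eq_single x⁻¹]
    · rw [if_pos]
      have := List.ofFn_get L
      conv_lhs => rw [← this]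
      simp
    · intro g _ hg
      rw [if_neg]
      intro h
      rw [List.map_cons, List.cons.injEq] at h
      exact hg (eq_inv_of_mul_eq_one_left h.1)
    · simp
    · intro s _ hs
      refine Finset.sum_eq_zero fun g _ => if_neg fun h => hs ?_
      rw [List.map_cons, List.cons.injEq] at h
      obtain rfl := eq_inv_of_mul_eq_one_left h.1
      have h2 := h.2
      conv_lhs at h2 => rw [← List.ofFn_get L, List.map_ofFn]
      exact (List.ofFn_injective h2).symm
    · simp

open Classical in
/-- The cochain that is supported on the `G`-orbit of the tuple `R` and takes the value `y` at `R`;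
it is zero if `R` does not have the right length. -/
noncomputable def orbitCochain (A : Rep.{w} ℤ G) (p : ℤ) (R : List G) : A →+ tateCochains A p :=
  AddMonoidHom.mk' (fun y => ⟨fun L => if L.length = len p then
      ∑ g : G, (if L = R.map (g * ·) then A.ρ g y else 0) else 0,
    fun h L => by
      simp only [List.length_map]
      split_ifs
      · rw [← Equiv.sum_comp (Equiv.mulLeft h), map_sum]
        refine Finset.sum_congr rfl fun g _ => ?_
        have : L.map (h * ·) = R.map (Equiv.mulLeft h g * ·) ↔ L = R.map (g * ·) := by
          rw [← (List.map_injective_iff.2 (mul_right_injective h)).eq_iff (a := L), List.map_map]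
          simp [Function.comp_def, mul_assoc]
        simp only [this]
        split_ifs
        · simp
        · simp
      · simp,
    fun L hL => if_neg hL⟩) (fun y y' => by
      ext L
      simp only [AddSubgroup.coe_add, Pi.add_apply]
      split_ifs
      · rw [← Finset.sum_add_distrib]
        refine Finset.sum_congr rfl fun g _ => ?_
        split_ifs <;> simp
      · simp)

open Classical in
lemma orbitCochain_apply (A : Rep.{w} ℤ G) (p : ℤ) (R : List G) (y : A) (L : List G) :
    (orbitCochain A p R y).1 L = if L.length = len p then
      ∑ g : G, (if L = R.map (g * ·) then A.ρ g y else 0) else 0 := rfl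

lemma orbitCochain_map (A : Rep.{w} ℤ G) (p : ℤ) (R : List G) (h : G) (y : A) :
    orbitCochain A p (R.map (h * ·)) y = orbitCochain A p R (A.ρ h⁻¹ y) := by
  classical
  ext L
  rw [orbitCochain_apply, orbitCochain_apply]
  congr 1
  rw [← Equiv.sum_comp (Equiv.mulRight h) fun g => if L = R.map (g * ·) then
    A.ρ g (A.ρ h⁻¹ y) else 0]
  refine Finset.sum_congr rfl fun g _ => ?_
  have : (R.map (h * ·)).map (g * ·) = R.map (Equiv.mulRight h g * ·) := by
    simp [Function.comp_def, mul_assoc]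
  rw [this]
  simp only [Equiv.coe_mulRight, map_mul, Module.End.mul_apply, Representation.self_inv_apply]
  congr

lemma orbitCochain_of_length_ne (A : Rep.{w} ℤ G) (p : ℤ) (R : List G) (hR : R.length ≠ len p)
    (y : A) : orbitCochain A p R y = 0 := by
  classical
  ext L
  rw [orbitCochain_apply]
  split_ifs with h
  · refine Finset.sum_eq_zero fun g _ => if_neg fun h' => hR ?_
    rw [← h, h', List.length_map]
  · rfl

lemma exists_len_eq (p : ℤ) : ∃ k, len p = k + 1 :=
  ⟨len p - 1, by simp only [len]; split_ifs <;> omega⟩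

/-- The terms of degrees `p` and `-1 - p` of the complete resolution are dual to each other, and so
have bases indexed by tuples of the same length. -/
lemma len_eq_len {p q : ℤ} (h : p + q = -1) : len p = len q := by
  simp only [len]; split_ifs <;> omega

/-- The orbit cochains of tuples that begin with `1` generate all cochains. -/
lemma eq_sum_orbitCochain (A : Rep.{w} ℤ G) (p : ℤ) {k : ℕ} (hk : len p = k + 1)
    (F : tateCochains A p) :
    F = ∑ s : Fin k → G, orbitCochain A p (1 :: List.ofFn s) (F.1 (1 :: List.ofFn s)) := by
  classical
  ext L
  rw [AddSubgroup.val_finsetSum, Finset.sum_apply]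
  simp only [orbitCochain_apply]
  split_ifs with h
  · rw [← sum_sum_ite_map_eq (h.trans hk) (F.1 L)]
    refine Finset.sum_congr rfl fun s _ => ?_
    rw [← Equiv.sum_comp (Equiv.inv G)]
    refine Finset.sum_congr rfl fun g _ => ?_
    have : L.map ((Equiv.inv G) g * ·) = 1 :: List.ofFn s ↔
        L = (1 :: List.ofFn s).map (g * ·) := by
      rw [← (List.map_injective_iff.2 (mul_right_injective g)).eq_iff, List.map_map]
      simp [Function.comp_def]
    simp only [this]
    split_ifs with hL
    · rw [hL, F.2.1]
    · rfl
  · rw [F.2.2 L h, Finset.sum_const_zero]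

variable {M : CochainComplex (Rep.{w} ℤ G) ℤ}

/-- The inclusion of `Hom_G(P_p, M^q)` into the product `Hom_G(P, M)^n`. -/
noncomputable def tateSingle (M : CochainComplex (Rep.{w} ℤ G) ℤ) {n : ℤ} (p q : ℤ)
    (h : p + q = n) : tateCochains (M.X q) p →+ TateTerm M n :=
  AddMonoidHom.single (fun x : {x : ℤ × ℤ // x.1 + x.2 = n} => tateCochains (M.X x.1.2) x.1.1)
    ⟨(p, q), h⟩

lemma tateSingle_comp {n : ℤ} (p q : ℤ) (h : p + q = n) (F : tateCochains (M.X q) p) :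
    (tateSingle M p q h F).comp p q h = F := Pi.single_eq_same _ _

lemma tateSingle_comp_of_ne {n : ℤ} (p q : ℤ) (h : p + q = n) (F : tateCochains (M.X q) p)
    {p' q' : ℤ} (h' : p' + q' = n) (hq : q' ≠ q) : (tateSingle M p q h F).comp p' q' h' = 0 :=
  Pi.single_eq_of_ne (fun h => hq (congrArg (fun x => x.1.2) h)) _

/-- Homomorphisms out of `RΓ̂(G, M)` are determined by their values on orbit cochains. -/
lemma tateTerm_hom_ext (hM : IsBounded M) {n : ℤ} {C : Type*} [AddCommGroup C]
    {T T' : TateTerm M n →+ C}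
    (h : ∀ (p q : ℤ) (hpq : p + q = n) (R : List G) (y : M.X q), R.length = len p →
      T (tateSingle M p q hpq (orbitCochain _ _ R y)) =
        T' (tateSingle M p q hpq (orbitCochain _ _ R y))) : T = T' := by
  obtain ⟨S, hS⟩ := hM.exists_finset
  have hsingle : ∀ (p q : ℤ) (hpq : p + q = n) (F : tateCochains (M.X q) p),
      T (tateSingle M p q hpq F) = T' (tateSingle M p q hpq F) := fun p q hpq F => by
    obtain ⟨k, hk⟩ := exists_len_eq p
    rw [eq_sum_orbitCochain _ _ hk F]
    simp only [map_sum]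
    exact Finset.sum_congr rfl fun s _ => h _ _ _ _ _ (by simp [hk])
  refine AddMonoidHom.ext fun g => ?_
  have hg : g = ∑ q ∈ S, tateSingle M (n - q) q (by omega) (g.comp (n - q) q (by omega)) := by
    funext ⟨⟨p, q⟩, hpq⟩
    rw [Finset.sum_apply]
    obtain rfl : p = n - q := by dsimp only at hpq; omega
    by_cases hq : q ∈ S
    · rw [Finset.sum_eq_single q]
      · exact (tateSingle_comp _ _ _ _).symm
      · exact fun q' _ hq' => tateSingle_comp_of_ne _ _ _ _ _ hq'.symm
      · exact fun h => absurd hq h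
    · ext L
      exact (hS q hq _).trans (hS q hq _).symm
  rw [hg, map_sum, map_sum]
  exact Finset.sum_congr rfl fun q _ => hsingle _ _ _ _

lemma cup_eq_sum {A B C : Type*} [AddCommGroup A] [AddCommGroup B] [AddCommGroup C] (a b : ℤ)
    (hab : a + b = -1) {k : ℕ} (hk : len a = k + 1) (β : A →+ B →+ C) (φ : List G → A)
    (ψ : List G → B) :
    cup a b β φ ψ [1] = ∑ s : Fin k → G,
      β (φ (1 :: List.ofFn s)) (ψ ((List.ofFn s).reverse ++ [1])) := by
  simp only [len] at hk
  split_ifs at hk with ha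
  · obtain rfl : k = a.toNat := by omega
    rw [cup, if_pos ha, if_neg (by omega), if_neg (by omega)]
    rfl
  · obtain rfl : k = b.toNat := by omega
    rw [cup, if_neg ha, if_pos (by omega), if_neg (by omega)]
    rfl

/-- The cup product into degree `-1` with the cochain supported on the orbit of `R` is evaluation
at the reversed tuple. -/
lemma cup_orbitCochain {A C : Type*} [AddCommGroup A] [AddCommGroup C] {B : Rep.{w} ℤ G} (a b : ℤ)
    (hab : a + b = -1) (β : A →+ B →+ C) (φ : List G → A)
    (hφ : ∀ (g : G) (X : List G) (y : B), β (φ (X.map (g * ·))) (B.ρ g y) = β (φ X) y)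
    (R : List G) (hR : R.length = len b) (y : B) :
    cup a b β φ (orbitCochain B b R y).1 [1] = β (φ R.reverse) y := by
  classical
  obtain ⟨k, hk⟩ := exists_len_eq a
  have hlen := len_eq_len hab
  rw [cup_eq_sum a b hab hk, ← sum_sum_ite_map_eq (L := R.reverse) (k := k)
    (by rw [List.length_reverse, hR, ← hlen, hk]) (β (φ R.reverse) y)]
  refine Finset.sum_congr rfl fun s _ => ?_
  rw [orbitCochain_apply, if_pos (by simp [← hlen, hk]), map_sum]
  refine Finset.sum_congr rfl fun g _ => ?_
  have : (List.ofFn s).reverse ++ [1] = R.map (g * ·) ↔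
      R.reverse.map (g * ·) = 1 :: List.ofFn s := by
    rw [← List.reverse_inj, List.map_reverse, eq_comm]
    simp
  simp only [this]
  split_ifs with h
  · rw [← h, hφ]
  · rw [map_zero]

/-- A cochain without rational components is paired with an orbit cochain by evaluating it, up to
sign, at the reversed tuple. -/
lemma pairing_single_orbitCochain {m : ℤ} {f : TateTerm (dual M) m}
    (hf : f ∈ torsionCochains M m) (a j b q : ℤ) (haj : a + j = m) (hqj : q + j = 1)
    (hbq : b + q = -m) (R : List G) (hR : R.length = len b) (y : M.X q) :
    pairing M f (tateSingle M b q hbq (orbitCochain (M.X q) b R y)) =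
      -((((-m) * a).negOnePow : ℤ) • evalQZ M j q hqj ((f.comp a j haj).1 R.reverse) y) := by
  set g : TateTerm M (-m) := tateSingle M b q hbq (orbitCochain (M.X q) b R y) with hg
  -- The summands with values in `ℚ` vanish since `f` has no rational components, and the others
  -- vanish for `r ≠ q` since `g` is concentrated in `M^q`.
  have e1 : ∀ r, cupTermQ M f g r [1] = 0 := fun r => by
    rw [cupTermQ, Pi.smul_apply]
    have : ∀ X y, evalQ M (-r) r (by omega) ((f.comp (m + r) (-r) (by omega)).1 X) y = 0 :=
      fun X y => hf _ _ _ _ _ _ _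
    simp [cup, this]
  have e2 : ∀ r, r ≠ q → cupTermQZ M f g r [1] = 0 := fun r hr => by
    rw [cupTermQZ, Pi.smul_apply]
    rw [tateSingle_comp_of_ne _ _ _ _ _ hr]
    simp [cup]
  rw [pairing, finsum_eq_zero_of_forall_eq_zero e1, finsum_eq_single _ q e2,
    cupTermQZ_eq f g q a j b (by omega) hqj (by omega), tateSingle_comp,
    cup_orbitCochain a b (by omega) _ _ (fun s X z => by
      rw [(f.comp a j haj).2.1 s X, evalQZ_act]) R hR]
  simp

/-- A cochain without rational components that pairs trivially with all orbit cochains is zero. -/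
lemma eq_zero_of_pairing_eq_zero {m : ℤ} {f : TateTerm (dual M) m}
    (hf : f ∈ torsionCochains M m) (h : ∀ g : TateTerm M (-m), pairing M f g = 0) : f = 0 := by
  funext ⟨⟨a, j⟩, haj⟩
  ext L
  dsimp only at haj
  refine Prod.ext (funext fun ⟨q, hq⟩ => AddMonoidHom.ext fun y => hf a j haj q hq L y)
    (funext fun ⟨q, hq⟩ => AddMonoidHom.ext fun y => ?_)
  change evalQZ M j q hq ((f.comp a j haj).1 L) y = 0
  have hqj : q + j = 1 := hq
  have hlen : len a = len (-m - q) := len_eq_len (by omega)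
  by_cases hL : L.length = len a
  · have := pairing_single_orbitCochain hf a j (-m - q) q haj hq (by omega) L.reverse
      (by rw [List.length_reverse, hL, hlen]) y
    rw [h, List.reverse_reverse, zero_eq_neg] at this
    rcases Int.units_eq_one_or (((-m) * a).negOnePow) with hs | hs <;> simpa [hs] using this
  · rw [(f.comp a j haj).2.2 L hL]
    rfl

/-- The cochain of `RΓ̂(G, Hom(M, ℚ/ℤ)[-1])` that represents a homomorphism `T` from `RΓ̂(G, M)` to
`ℚ/ℤ`: its value at a tuple `L` is the restriction of `T` to the cochains supported on the orbit of
the reversed tuple, up to the sign in `pairing_single_orbitCochain`. -/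
noncomputable def representingCochain {m : ℤ} (T : TateTerm M (-m) →+ AddCircle (1 : ℚ)) :
    TateTerm (dual M) m :=
  fun ⟨(a, j), haj⟩ => ⟨fun L => show DualTerm M j from
    (0, fun q => -((((-m) * a).negOnePow : ℤ) • 
      (T.comp ((tateSingle M (-m - q) q (by omega)).comp
        (orbitCochain (M.X q) (-m - q) L.reverse))))),
    fun g L => by
      refine Prod.ext rfl (funext fun ⟨q, hq⟩ => AddMonoidHom.ext fun y => ?_)
      change -((((-m) * a).negOnePow : ℤ) • T (tateSingle M _ q _ (orbitCochain (M.X q) (-m - q)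
        (L.map (g * ·)).reverse y))) = -((((-m) * a).negOnePow : ℤ) • T (tateSingle M _ q _
          (orbitCochain (M.X q) (-m - q) L.reverse ((M.X q).ρ g⁻¹ y))))
      rw [← List.map_reverse, orbitCochain_map],
    fun L hL => by
      refine Prod.ext rfl (funext fun ⟨q, hq⟩ => AddMonoidHom.ext fun y => ?_)
      change -((((-m) * a).negOnePow : ℤ) • T (tateSingle M _ q _ (orbitCochain (M.X q) (-m - q)
        L.reverse y))) = 0
      have hlen : len a = len (-m - q) := len_eq_len (by dsimp only at haj; omega)
      rw [orbitCochain_of_length_ne _ _ _ (by rwa [List.length_reverse, ← hlen]), map_zero,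
        map_zero, smul_zero, neg_zero]⟩

lemma representingCochain_mem {m : ℤ} (T : TateTerm M (-m) →+ AddCircle (1 : ℚ)) :
    representingCochain T ∈ torsionCochains M m := fun _ _ _ _ _ _ _ => rfl

lemma pairing_representingCochain (hM : IsBounded M) {m : ℤ}
    (T : TateTerm M (-m) →+ AddCircle (1 : ℚ)) :
    AddMonoidHom.mk' (fun g : TateTerm M (-m) => pairing M (representingCochain T) g)
      (pairing_add_right hM _) = T := by
  refine tateTerm_hom_ext hM fun b q hbq R y hR => ?_
  refine (pairing_single_orbitCochain (representingCochain_mem T) (m + q - 1) (1 - q) b q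
    (by omega) (by omega) hbq R hR y).trans ?_
  obtain rfl : b = -m - q := by omega
  change -((((-m) * (m + q - 1)).negOnePow : ℤ) • -((((-m) * (m + q - 1)).negOnePow : ℤ) •
    T (tateSingle M _ q _ (orbitCochain (M.X q) (-m - q) R.reverse.reverse y)))) = _
  rw [List.reverse_reverse, smul_neg, neg_neg, smul_smul, sgn_mul, Int.negOnePow_even _ ⟨_, rfl⟩]
  simp

end Orbit

end TateDuality

/-! ### The duality theorem -/

open TateDuality in
theorem mainTheorem12 {G : Type u} [Group G] [Fintype G]
    (M : CochainComplex (Rep.{w} ℤ G) ℤ) (hM : TateDuality.IsBounded M)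
    (hfg : ∀ i : ℤ, Module.Finite ℤ (M.homology i)) :
    QuasiIso (TateDuality.dualityMap M hM) := by
  have hd : ∀ (n n' : ℤ) (h : n + 1 = n'), (tateComplex (dual M)).d n n' =
      AddCommGrpCat.ofHom (tateD (dual M) n n' h) := fun n n' h => dif_pos h
  refine quasiIso_of_bijOn _ (torsionCochains M) (fun n x hx => ?_) (fun n x hx => ?_)
    (fun n x hx h0 => ?_) (fun n y => ?_)
  · rw [hd n (n + 1) rfl]
    exact tateD_mem_torsionCochains rfl hx
  · rw [hd n (n + 1) rfl] at hx
    rw [hd (n - 1) n (by omega)]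
    exact ⟨_, sub_tateD_tateContraction_mem (by omega) rfl x hx⟩
  · exact eq_zero_of_pairing_eq_zero hx fun g =>
      DFunLike.congr_fun (F := TateTerm M (-n) →+ AddCircle (1 : ℚ)) h0 g
  · exact ⟨_, representingCochain_mem y, pairing_representingCochain hM y⟩
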